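/- **Setting.** Let $n\ge 0$ and let $\Gamma^A=(x^i,\xi_{1i},\xi_{2\alpha})$, $i,\alpha=1,\dots,n$, be coordinates of Grassmann parities $\epsilon(x^i)=\epsilon(i)$, $\epsilon(\xi_{1i})=\epsilon(i)+1$, $\epsilon(\xi_{2\alpha})=\epsilon(\alpha)+1$, with arbitrary $\epsilon(i),\epsilon(\alpha)\in\mathbb Z/2$. The assertion is local: the even coordinates range over an open box $U$ (a product of open, possibly unbounded, intervals), and "function" means an element of $C^\infty(U)\otimes\Lambda(\theta)$, where $\theta$ are the odd coordinates. Write $\partial_A$ and $\overleftarrow\partial_A$ for left and right partial derivatives; repeated indices are summed. Let $e^i_\alpha=e^i_\alpha(\xi_1,\xi_2)$ be functions independent of $x$, of parity $\epsilon(i)+\epsilon(\alpha)$, forming an invertible matrix, and for homogeneous functions $F,G$ put $$(F,G)^1=F\frac{\overleftarrow\partial}{\partial x^i}\,\frac{\partial G}{\partial\xi_{1i}}-(-1)^{(\epsilon(F)+1)(\epsilon(G)+1)}(F\leftrightarrow G),\qquad (F,G)^2=F\frac{\overleftarrow\partial}{\partial x^i}\,e^i_\alpha\,\frac{\partial G}{\partial\xi_{2\alpha}}-(-1)^{(\epsilon(F)+1)(\epsilon(G)+1)}(F\leftrightarrow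 G),$$ extended bilinearly. Assume that these are compatible antibrackets: for all real constants $a,b$ the operation $(\,,\,)=a(\,,\,)^1+b(\,,\,)^2$ is bilinear, has $\epsilon((F,G))=\epsilon(F)+\epsilon(G)+1$, and satisfies $(F,G)=-(-1)^{(\epsilon(F)+1)(\epsilon(G)+1)}(G,F)$, $(F,GK)=(F,G)K+(-1)^{(\epsilon(F)+1)\epsilon(G)}G(F,K)$ and $(-1)^{(\epsilon(F)+1)(\epsilon(K)+1)}(F,(G,K))+\mathrm{cycle}(F,G,K)=0$ for all homogeneous $F,G,K$. Put $E^{aAB}=(\Gamma^A,\Gamma^B)^a$, let $F_A$ be functions with $\epsilon(F_A)=\epsilon(\Gamma^A)$, and define the odd vector fields $$V^a=(-1)^{\epsilon(\Gamma^C)}E^{aCB}F_B\,\partial_C,\qquad a=1,2.$$ **Claim.** The following are equivalent. 1. The $V^a$ differentiate the antibrackets in the symmetrized sense: for all $a,b\in\{1,2\}$ and all homogeneous functions $F,G$, $$V^a(F,G)^b+V^b(F,G)^a=(V^aF,G)^b+(V^bF,G)^a+(-1)^{\epsilon(F)+1}\big[(F,V^aG)^b+(F,V^bG)^a\big].$$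 2. There exist even functions $H$ and $h$ such that $H=H(\xi_1,\xi_2)$ is independent of $x$ and satisfies, for all $i,j$, $$e^i_\alpha\frac{\partial}{\partial\xi_{2\alpha}}\frac{\partial}{\partial\xi_{1j}}H-(-1)^{(\epsilon(i)+1)(\epsilon(j)+1)}\,e^j_\alpha\frac{\partial}{\partial\xi_{2\alpha}}\frac{\partial}{\partial\xi_{1i}}H=0,$$ while $h=h(x,\xi_1,\xi_2)$ is subject to no further condition, and $$V^1=(-\tfrac12H,\,\cdot\,)^1+(h,\,\cdot\,)^1,\qquad V^2=(\tfrac12H,\,\cdot\,)^2+(h,\,\cdot\,)^2 .$$ -/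

import Mathlib

open scoped TensorProduct ContDiff

noncomputable section

namespace Triplectic

/-! ### Superfunctions on a superdomain -/

section Superdomain

/-- The algebra `C^∞(U)` of smooth real functions on an open set `U` of the space `ℝ^ι`. -/
def smoothFun {ι : Type} [Fintype ι] (U : TopologicalSpace.Opens (ι → ℝ)) :
    Subalgebra ℝ (U → ℝ) where
  carrier := {f | ContDiffOn ℝ ∞ (Function.extend Subtype.val f 0) (U : Set (ι → ℝ))}
  mul_mem' {f g} hf hg := (ContDiffOn.mul hf hg).congr fun u hu => by
    have h := fun k : U → ℝ => Subtype.val_injective.extend_apply k 0 ⟨u, hu⟩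
    simp only at h
    simp [h]
  add_mem' {f g} hf hg := (ContDiffOn.add hf hg).congr fun u hu => by
    have h := fun k : U → ℝ => Subtype.val_injective.extend_apply k 0 ⟨u, hu⟩
    simp only at h
    simp [h]
  algebraMap_mem' r := (contDiffOn_const (c := r)).congr fun u hu => by
    have h := fun k : U → ℝ => Subtype.val_injective.extend_apply k 0 ⟨u, hu⟩
    simp only at h
    simp [h]

/-- A member of `smoothFun U`, extended by zero outside `U`. -/
def smoothExt {ι : Type} [Fintype ι] {U : TopologicalSpace.Opens (ι → ℝ)} (f : smoothFun U) :
    (ι → ℝ) → ℝ :=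
  Function.extend Subtype.val (f : U → ℝ) 0

theorem smoothExt_apply {ι : Type} [Fintype ι] {U : TopologicalSpace.Opens (ι → ℝ)}
    (f : smoothFun U) (u : U) : smoothExt f u = (f : U → ℝ) u :=
  Subtype.val_injective.extend_apply _ _ _

theorem smoothExt_contDiffOn {ι : Type} [Fintype ι] {U : TopologicalSpace.Opens (ι → ℝ)}
    (f : smoothFun U) : ContDiffOn ℝ ∞ (smoothExt f) (U : Set (ι → ℝ)) :=
  f.2

theorem smoothExt_differentiableAt {ι : Type} [Fintype ι]
    {U : TopologicalSpace.Opens (ι → ℝ)} (f : smoothFun U) (u : U) :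
    DifferentiableAt ℝ (smoothExt f) (u : ι → ℝ) :=
  ((smoothExt_contDiffOn f).contDiffAt (U.isOpen.mem_nhds u.2)).differentiableAt (by simp)

/-- The partial derivative `∂/∂u_a : C^∞(U) → C^∞(U)`. -/
def partialDeriv {ι : Type} [Fintype ι] [DecidableEq ι] {U : TopologicalSpace.Opens (ι → ℝ)}
    (a : ι) : smoothFun U →ₗ[ℝ] smoothFun U where
  toFun f := ⟨fun u => fderiv ℝ (smoothExt f) (u : ι → ℝ) (Pi.single a 1), by
    have h1 : ContDiffOn ℝ ∞ (fderiv ℝ (smoothExt f)) (U : Set (ι → ℝ)) :=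
      (smoothExt_contDiffOn f).fderiv_of_isOpen U.isOpen (by simp)
    have h2 : ContDiffOn ℝ ∞ (fun u => fderiv ℝ (smoothExt f) u (Pi.single a 1))
        (U : Set (ι → ℝ)) := h1.clm_apply contDiffOn_const
    exact h2.congr fun u hu => Subtype.val_injective.extend_apply _ _ (⟨u, hu⟩ : U)⟩
  map_add' f g := by
    apply Subtype.ext
    funext u
    have h : smoothExt (f + g) =ᶠ[nhds (u : ι → ℝ)] smoothExt f + smoothExt g := by
      filter_upwards [U.isOpen.mem_nhds u.2] with v hv
      have := smoothExt_apply (f + g) ⟨v, hv⟩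
      have hf := smoothExt_apply f ⟨v, hv⟩
      have hg := smoothExt_apply g ⟨v, hv⟩
      simp only at this hf hg
      simp [this, hf, hg]
    have h' := fderiv_add (smoothExt_differentiableAt f u) (smoothExt_differentiableAt g u)
    change fderiv ℝ (smoothExt (f + g)) u (Pi.single a 1) = _
    rw [h.fderiv_eq, h']
    rfl
  map_smul' r f := by
    apply Subtype.ext
    funext u
    have h : smoothExt (r • f) =ᶠ[nhds (u : ι → ℝ)] r • smoothExt f := by
      filter_upwards [U.isOpen.mem_nhds u.2] with v hv
      have := smoothExt_apply (r • f) ⟨v, hv⟩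
      have hf := smoothExt_apply f ⟨v, hv⟩
      simp only at this hf
      simp [this, hf]
    have h' := fderiv_const_smul (smoothExt_differentiableAt f u) r
    change fderiv ℝ (smoothExt (r • f)) u (Pi.single a 1) = _
    rw [h.fderiv_eq, h']
    rfl

/-- The coordinate function `u_a` on `U`. -/
def coordFun {ι : Type} [Fintype ι] {U : TopologicalSpace.Opens (ι → ℝ)} (a : ι) :
    smoothFun U :=
  ⟨fun u => (u : ι → ℝ) a, by
    have h : ContDiffOn ℝ ∞ (fun u : ι → ℝ => u a) (U : Set (ι → ℝ)) :=
      (contDiff_apply ℝ ℝ a).contDiffOn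
    exact h.congr fun u hu => Subtype.val_injective.extend_apply _ _ (⟨u, hu⟩ : U)⟩

/-- `U` is an open coordinate box: a product of (possibly unbounded) open intervals. -/
def IsBox {ι : Type} (U : TopologicalSpace.Opens (ι → ℝ)) : Prop :=
  ∃ I : ι → Set ℝ, (∀ a, IsOpen (I a) ∧ (I a).OrdConnected) ∧
    (U : Set (ι → ℝ)) = Set.univ.pi I

/-- The sign `(-1)^p`. -/
def sgn (p : ZMod 2) : ℝ := if p = 0 then 1 else -1

/-- Values of the even coordinates, for coordinates with Grassmann parities `par`. -/
abbrev EvenSpace {ι : Type} (par : ι → ZMod 2) : Type := {A // par A = 0} → ℝ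

/-- The span of the odd coordinates, for coordinates with Grassmann parities `par`. -/
abbrev OddSpace {ι : Type} (par : ι → ZMod 2) : Type := {A // par A ≠ 0} → ℝ

variable {ι : Type} [Fintype ι] [DecidableEq ι] {par : ι → ZMod 2}

/-- The algebra `C^∞(U) ⊗ Λ(θ)` of functions on the superdomain over `U`; its even coordinates
are the coordinates of `U`, its odd coordinates are the generators `θ` of the exterior algebra. -/
abbrev SuperFun {par : ι → ZMod 2} (U : TopologicalSpace.Opens (EvenSpace par)) : Type :=
  smoothFun U ⊗[ℝ] ExteriorAlgebra ℝ (OddSpace par)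

variable {U : TopologicalSpace.Opens (EvenSpace par)}

/-- The coordinate `Γ^A`, as a superfunction. -/
def coord (U : TopologicalSpace.Opens (EvenSpace par)) (A : ι) : SuperFun U :=
  if h : par A = 0 then coordFun ⟨A, h⟩ ⊗ₜ[ℝ] 1
  else 1 ⊗ₜ[ℝ] ExteriorAlgebra.ι ℝ (Pi.single ⟨A, h⟩ 1)

/-- The left partial derivative `∂_A`. For an odd `Γ^A = θ` it removes `θ` from the left:
`∂_θ (θ g) = g - θ ∂_θ g`. -/
def leftD (A : ι) : SuperFun U →ₗ[ℝ] SuperFun U :=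
  if h : par A = 0 then (partialDeriv ⟨A, h⟩).rTensor _
  else (CliffordAlgebra.contractLeft (LinearMap.proj ⟨A, h⟩)).lTensor _

/-- The right partial derivative. For an odd `Γ^A = θ` it removes `θ` from the right. -/
def rightD (A : ι) : SuperFun U →ₗ[ℝ] SuperFun U :=
  if h : par A = 0 then (partialDeriv ⟨A, h⟩).rTensor _
  else (CliffordAlgebra.contractRight.flip (LinearMap.proj ⟨A, h⟩)).lTensor _

/-- The parity automorphism, which changes the sign of all the odd coordinates. -/
def parityAut : SuperFun U →ₗ[ℝ] SuperFun U :=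
  (CliffordAlgebra.involute (Q := (0 : QuadraticForm ℝ (OddSpace par)))).toLinearMap.lTensor _

/-- `f` is homogeneous of Grassmann parity `p`. -/
def HasParity (f : SuperFun U) (p : ZMod 2) : Prop := parityAut f = sgn p • f

/-- The homogeneous component of `f` of parity `p`. -/
def parityPart (p : ZMod 2) (f : SuperFun U) : SuperFun U :=
  (1 / 2 : ℝ) • (f + sgn p • parityAut f)

/-! ### Antibrackets -/

/-- The axioms of an antibracket. -/
structure IsAntibracket (B : SuperFun U → SuperFun U → SuperFun U) : Prop where
  add_left : ∀ F G H, B (F + G) H = B F H + B G H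
  smul_left : ∀ (r : ℝ) F G, B (r • F) G = r • B F G
  add_right : ∀ F G H, B F (G + H) = B F G + B F H
  smul_right : ∀ (r : ℝ) F G, B F (r • G) = r • B F G
  parity : ∀ F G p q, HasParity F p → HasParity G q → HasParity (B F G) (p + q + 1)
  antisymm : ∀ F G p q, HasParity F p → HasParity G q →
    B F G = -(sgn ((p + 1) * (q + 1)) • B G F)
  leibniz : ∀ F G H p q r, HasParity F p → HasParity G q → HasParity H r →
    B F (G * H) = B F G * H + sgn ((p + 1) * q) • (G * B F H)
  jacobi : ∀ F G H p q r, HasParity F p → HasParity G q → HasParity H r →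
    sgn ((p + 1) * (r + 1)) • B F (B G H) + sgn ((q + 1) * (p + 1)) • B G (B H F)
      + sgn ((r + 1) * (q + 1)) • B H (B F G) = 0

/-- The pair `B 0`, `B 1` is compatible: all its linear combinations are antibrackets. -/
def Compatible (B : Fin 2 → SuperFun U → SuperFun U → SuperFun U) : Prop :=
  ∀ α β : ℝ, IsAntibracket fun F G => α • B 0 F G + β • B 1 F G

/-- For a bilinear `K`, the bilinear operation given on homogeneous `F`, `G` of parities `p`, `q`
by `K(F, G) - (-1)^((p+1)(q+1)) K(G, F)`. -/
def antisymmetrize (K : SuperFun U → SuperFun U → SuperFun U) (F G : SuperFun U) : SuperFun U :=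
  K F G - ∑ p : ZMod 2, ∑ q : ZMod 2,
    sgn ((p + 1) * (q + 1)) • K (parityPart q G) (parityPart p F)

/-- The components `E^{AB} = (Γ^A, Γ^B)` of a bracket. -/
def components (B : SuperFun U → SuperFun U → SuperFun U) (A C : ι) : SuperFun U :=
  B (coord U A) (coord U C)

/-- The vector field `(-1)^{ε(C)} E^{CB} Φ_B ∂_C` made of a bracket and a covector field `Φ`. -/
def vectorField (B : SuperFun U → SuperFun U → SuperFun U) (Φ : ι → SuperFun U)
    (f : SuperFun U) : SuperFun U :=
  ∑ C, ∑ A, sgn (par C) • (components B C A * Φ A * leftD C f)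

/-- The vector fields `V 0`, `V 1` differentiate the brackets `B 0`, `B 1` in the sense
symmetrized over the labels. -/
def DifferentiateSymm (V : Fin 2 → SuperFun U → SuperFun U)
    (B : Fin 2 → SuperFun U → SuperFun U → SuperFun U) : Prop :=
  ∀ (a b : Fin 2) (F G : SuperFun U) (p q : ZMod 2), HasParity F p → HasParity G q →
    V a (B b F G) + V b (B a F G) =
      (B b (V a F) G + B a (V b F) G) + sgn (p + 1) • (B b F (V a G) + B a F (V b G))

end Superdomain

/-! ### Triplectic coordinates and weakly canonical brackets -/

/-- Labels of the coordinates `x^i`, `ξ_{1i}`, `ξ_{2α}`. -/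
abbrev Idx (n : ℕ) : Type := Fin n ⊕ Fin n ⊕ Fin n

/-- The label of `x^i`. -/
abbrev ix {n : ℕ} (i : Fin n) : Idx n := Sum.inl i

/-- The label of `ξ_{1i}`. -/
abbrev i1 {n : ℕ} (i : Fin n) : Idx n := Sum.inr (Sum.inl i)

/-- The label of `ξ_{2α}`. -/
abbrev i2 {n : ℕ} (α : Fin n) : Idx n := Sum.inr (Sum.inr α)

/-- The parities `ε(x^i) = ε(i)`, `ε(ξ_{1i}) = ε(i) + 1`, `ε(ξ_{2α}) = ε(α) + 1`, where
`εi i` is `ε(i)` and `εα α` is `ε(α)`. -/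
def parity {n : ℕ} (εi εα : Fin n → ZMod 2) : Idx n → ZMod 2 :=
  Sum.elim εi (Sum.elim (fun i => εi i + 1) (fun α => εα α + 1))

variable {n : ℕ} {εi εα : Fin n → ZMod 2}
  {U : TopologicalSpace.Opens (EvenSpace (parity εi εα))}

/-- `f` does not depend on the coordinates `x`. -/
def IndepX (f : SuperFun U) : Prop := ∀ i : Fin n, leftD (ix i) f = 0

/-- `e^i_α = e i α` is an admissible matrix for weakly canonical brackets: homogeneous of parities
`ε(i) + ε(α)`, a function of `ξ_1`, `ξ_2` only, and nondegenerate. -/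
structure IsEStructure (e : Matrix (Fin n) (Fin n) (SuperFun U)) : Prop where
  parity : ∀ i α, HasParity (e i α) (εi i + εα α)
  indep : ∀ i α, IndepX (e i α)
  nondeg : IsUnit e

/-- The pair of brackets of weakly canonical form (label `0` is the first bracket):
`(F,G)^1 = (F ∂⃖_{x^i}) ∂_{ξ_{1i}} G - (-1)^{(ε(F)+1)(ε(G)+1)} (F ↔ G)` and
`(F,G)^2 = (F ∂⃖_{x^i}) e^i_α ∂_{ξ_{2α}} G - (-1)^{(ε(F)+1)(ε(G)+1)} (F ↔ G)`. -/
def weakBracket (e : Matrix (Fin n) (Fin n) (SuperFun U)) :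
    Fin 2 → SuperFun U → SuperFun U → SuperFun U :=
  ![antisymmetrize fun F G => ∑ i, rightD (ix i) F * leftD (i1 i) G,
    antisymmetrize fun F G => ∑ i, ∑ α, rightD (ix i) F * e i α * leftD (i2 α) G]

/-- The equation `e^i_α ∂_{ξ_{2α}} ∂_{ξ_{1j}} H
- (-1)^{(ε(i)+1)(ε(j)+1)} e^j_α ∂_{ξ_{2α}} ∂_{ξ_{1i}} H = 0` for all `i`, `j`. -/
def SolvesHEquation (e : Matrix (Fin n) (Fin n) (SuperFun U)) (H : SuperFun U) : Prop :=
  ∀ i j : Fin n,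
    ∑ α, e i α * leftD (i2 α) (leftD (i1 j) H)
      - sgn ((εi i + 1) * (εi j + 1)) • ∑ α, e j α * leftD (i2 α) (leftD (i1 i) H) = 0

end Triplectic

end

/-! Write T^1_i = ∂_{ξ_{1i}} and T^2_i = e^i_α ∂_{ξ_{2α}} for the operators (x^i, ·)^a; in the code
the labels 1, 2 are 0, 1. The proof compares two expressions of the same shape. For even h, the
field (h, ·)^a is Σ ± (∂_{x^i} h · T^a_i + T^a_i h · ∂_{x^i}) (`bracket_even_left`), while V^a is
the same sum with F_{x^i} in place of ∂_{x^i} h and the contraction of F with the coefficients of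
T^a_i in place of T^a_i h (`vectorField_bracket`). So V^a is Hamiltonian as soon as F is a gradient
along x and ξ_a.

From 1 to 2: the case a = b, tested on pairs of coordinates, says that F is closed along (x, ξ_1)
and, once e is inverted, along (x, ξ_2) (`twist_momComp_of_symm`, `twist_x_of_symm`, `D_x_of_symm`,
`D_i2_x_of_symm`, `D_i2_i2_of_symm`). The Poincaré lemma on the box (`exists_potential`) then gives
potentials h_1, h_2 with V^a = (h_a, ·)^a. Both have x-gradient F_x, so H = h_2 - h_1 does not
depend on x, and h is their mean. The case a ≠ b, tested on (x^i, x^j), becomes the equation for H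
after the mixed commutation of T^1 and T^2, which is the Jacobi identity of the sum of the brackets.

From 2 to 1: the Jacobi identities of the two brackets and of their sum show that any even function
generates fields with the symmetrized property. What is left is that (H, ·)^1 alone differentiates
the second bracket. It is a shift of x by functions η_i = ∂_{ξ_{1i}} H of the momenta, and the
equation for H says exactly that T^2_i η_j is supersymmetric, which is what such a shift needs
(`shift_bracket`).

The sign calculus is done over the abstract structure `SuperCalculus`; superfunctions on a box are
an instance, and the box enters only through primitives along a coordinate. -/

noncomputable section
namespace Triplectic

/-! ### Smooth functions on a box -/

section ParametricIntegral

open Set MeasureTheory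

variable {E : Type} [NormedAddCommGroup E] [NormedSpace ℝ E] [ProperSpace E]

/-- Differentiation under the integral sign over the unit interval. -/
theorem hasFDerivAt_integral_of_contDiffOn {F : Type} [NormedAddCommGroup F] [NormedSpace ℝ F]
    {g : E × ℝ → F} {V : Set E} {W : Set (E × ℝ)} (hV : IsOpen V)
    (hW : IsOpen W) (hVW : V ×ˢ Icc (0 : ℝ) 1 ⊆ W) (hg : ContDiffOn ℝ ∞ g W) {x : E}
    (hx : x ∈ V) :
    HasFDerivAt (fun x => ∫ s in (0 : ℝ)..1, g (x, s))
      (∫ s in (0 : ℝ)..1, (fderiv ℝ g (x, s)).comp (ContinuousLinearMap.inl ℝ E ℝ)) x := by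
  have hg' : ContDiffOn ℝ ∞ (fun p => (fderiv ℝ g p).comp (ContinuousLinearMap.inl ℝ E ℝ)) W :=
    (hg.fderiv_of_isOpen hW (by simp)).clm_comp contDiffOn_const
  -- A closed ball times the unit interval is compact, so the derivative has one bound M there; this
  -- constant is the dominating function.
  obtain ⟨δ, hδ, hball⟩ := Metric.nhds_basis_closedBall.mem_iff.1 (hV.mem_nhds hx)
  have hK : IsCompact (Metric.closedBall x δ ×ˢ Icc (0 : ℝ) 1) :=
    (isCompact_closedBall x δ).prod isCompact_Icc
  have hKW : Metric.closedBall x δ ×ˢ Icc (0 : ℝ) 1 ⊆ W :=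
    (prod_mono_left hball).trans hVW
  obtain ⟨M, hM⟩ := hK.exists_bound_of_continuousOn (hg'.continuousOn.mono hKW)
  have hI : uIoc (0 : ℝ) 1 ⊆ Icc 0 1 := by
    rw [uIoc_of_le zero_le_one]; exact Ioc_subset_Icc_self
  have hslice : ∀ {G : Type} [NormedAddCommGroup G] {k : E × ℝ → G}, ContinuousOn k W →
      ∀ y ∈ V, ContinuousOn (fun s => k (y, s)) (Icc (0 : ℝ) 1) := fun hk y hy =>
    hk.comp (by fun_prop) fun s hs => hVW ⟨hy, hs⟩
  have hmeas : ∀ {G : Type} [NormedAddCommGroup G] {k : E × ℝ → G}, ContinuousOn k W →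
      ∀ y ∈ V, AEStronglyMeasurable (fun s => k (y, s)) (volume.restrict (uIoc (0 : ℝ) 1)) :=
    fun hk y hy => ((hslice hk y hy).aestronglyMeasurable measurableSet_Icc).mono_measure
      (Measure.restrict_mono hI le_rfl)
  refine intervalIntegral.hasFDerivAt_integral_of_dominated_of_fderiv_le
    (s := Metric.closedBall x δ) (bound := fun _ => M)
    (F' := fun x s => (fderiv ℝ g (x, s)).comp (ContinuousLinearMap.inl ℝ E ℝ))
    (Metric.closedBall_mem_nhds x hδ) ?_ ?_ (hmeas hg'.continuousOn x hx) ?_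
    intervalIntegrable_const ?_
  · filter_upwards [hV.mem_nhds hx] with y hy using hmeas hg.continuousOn y hy
  · exact ContinuousOn.intervalIntegrable_of_Icc zero_le_one (hslice hg.continuousOn x hx)
  · exact Filter.Eventually.of_forall fun s hs y hy => hM (y, s) ⟨hy, hI hs⟩
  · refine Filter.Eventually.of_forall fun s hs y hy => ?_
    have hmem : (y, s) ∈ W := hKW ⟨hy, hI hs⟩
    have hd : HasFDerivAt g (fderiv ℝ g (y, s)) (y, s) :=
      ((hg.contDiffAt (hW.mem_nhds hmem)).differentiableAt (by simp)).hasFDerivAt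
    exact hd.comp y (hasFDerivAt_prodMk_left y s)

/-- Integration over the unit interval preserves smooth dependence on parameters. -/
theorem contDiffOn_integral {g : E × ℝ → ℝ} {V : Set E}
    {W : Set (E × ℝ)} (hV : IsOpen V) (hW : IsOpen W) (hVW : V ×ˢ Icc (0 : ℝ) 1 ⊆ W)
    (hg : ContDiffOn ℝ ∞ g W) : ContDiffOn ℝ ∞ (fun x => ∫ s in (0 : ℝ)..1, g (x, s)) V := by
  -- The codomain must vary in the induction on the order of smoothness: the derivative of the
  -- integral is again such an integral, with values in a space of linear maps.
  suffices H : ∀ (n : ℕ) (F : Type) [NormedAddCommGroup F] [NormedSpace ℝ F] (g : E × ℝ → F),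
      ContDiffOn ℝ ∞ g W → ContDiffOn ℝ n (fun x => ∫ s in (0 : ℝ)..1, g (x, s)) V from
    contDiffOn_infty.2 fun n => H n ℝ g hg
  intro n
  induction n with
  | zero =>
    intro F _ _ g hg
    exact contDiffOn_zero.2 fun x hx =>
      (hasFDerivAt_integral_of_contDiffOn hV hW hVW hg hx).continuousAt.continuousWithinAt
  | succ n ih =>
    intro F _ _ g hg
    push_cast
    rw [contDiffOn_succ_iff_fderiv_of_isOpen hV]
    refine ⟨fun x hx => (hasFDerivAt_integral_of_contDiffOn hV hW hVW hg
      hx).differentiableAt.differentiableWithinAt, by simp, ?_⟩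
    refine (ih _ _ ((hg.fderiv_of_isOpen hW (m := ∞) (by simp)).clm_comp
      (contDiffOn_const (c := ContinuousLinearMap.inl ℝ E ℝ)))).congr fun x hx => ?_
    exact (hasFDerivAt_integral_of_contDiffOn hV hW hVW hg hx).fderiv

end ParametricIntegral

/-! ### Partial derivatives and primitives of smooth functions -/

section SmoothFun

open Set

variable {ι : Type} [Fintype ι] {U : TopologicalSpace.Opens (ι → ℝ)}

theorem smoothFun_ext {f g : smoothFun U}
    (h : ∀ u : U, (f : U → ℝ) u = (g : U → ℝ) u) : f = g :=
  Subtype.ext (funext h)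

/-- The member of `smoothFun U` given by a function that is smooth on `U`. -/
def ofContDiffOn (U : TopologicalSpace.Opens (ι → ℝ)) (f : (ι → ℝ) → ℝ)
    (hf : ContDiffOn ℝ ∞ f U) : smoothFun U :=
  ⟨fun u => f u, hf.congr fun u hu => Subtype.val_injective.extend_apply _ _ (⟨u, hu⟩ : U)⟩

theorem smoothExt_eventuallyEq {f : smoothFun U} {g : (ι → ℝ) → ℝ}
    (h : ∀ u : U, (f : U → ℝ) u = g u) (u : U) : smoothExt f =ᶠ[nhds (u : ι → ℝ)] g := by
  filter_upwards [U.isOpen.mem_nhds u.2] with v hv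
  rw [← h ⟨v, hv⟩]
  exact smoothExt_apply f ⟨v, hv⟩

variable [DecidableEq ι]

theorem partialDeriv_apply (a : ι) (f : smoothFun U) (u : U) :
    (partialDeriv a f : U → ℝ) u = fderiv ℝ (smoothExt f) (u : ι → ℝ) (Pi.single a 1) := rfl

/-- Since U is open, the derivative sees only values on U, so any convenient formula may replace the
extension by zero. -/
theorem partialDeriv_apply_of_eq {a : ι} {f : smoothFun U} {g : (ι → ℝ) → ℝ}
    (h : ∀ u : U, (f : U → ℝ) u = g u) (u : U) :
    (partialDeriv a f : U → ℝ) u = fderiv ℝ g (u : ι → ℝ) (Pi.single a 1) := by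
  rw [partialDeriv_apply, (smoothExt_eventuallyEq h u).fderiv_eq]

theorem partialDeriv_mul (a : ι) (f g : smoothFun U) :
    partialDeriv a (f * g) = partialDeriv a f * g + f * partialDeriv a g := by
  apply smoothFun_ext
  intro u
  rw [partialDeriv_apply_of_eq (g := fun v => smoothExt f v * smoothExt g v)
    (fun v => by simp [smoothExt_apply]),
    fderiv_fun_mul (smoothExt_differentiableAt f u) (smoothExt_differentiableAt g u)]
  simp only [add_apply, smul_apply, smul_eq_mul,
    smoothExt_apply, MulMemClass.coe_mul, AddMemClass.coe_add, Pi.add_apply, Pi.mul_apply,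
    partialDeriv_apply]
  ring

theorem partialDeriv_one (a : ι) : partialDeriv a (1 : smoothFun U) = 0 := by
  apply smoothFun_ext
  intro u
  rw [partialDeriv_apply_of_eq (g := fun _ => (1 : ℝ)) (fun v => by simp)]
  simp

theorem partialDeriv_coordFun (a b : ι) :
    partialDeriv a (coordFun b : smoothFun U) = if a = b then 1 else 0 := by
  apply smoothFun_ext
  intro u
  rw [partialDeriv_apply_of_eq (g := fun v => v b) (fun v => rfl)]
  have : HasFDerivAt (fun v : ι → ℝ => v b) (ContinuousLinearMap.proj b) (u : ι → ℝ) :=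
    (ContinuousLinearMap.proj (R := ℝ) (φ := fun _ : ι => ℝ) b).hasFDerivAt
  rw [this.fderiv]
  by_cases h : a = b
  · subst h; simp
  · simp [h, Ne.symm h]

theorem partialDeriv_comm (a b : ι) (f : smoothFun U) :
    partialDeriv a (partialDeriv b f) = partialDeriv b (partialDeriv a f) := by
  apply smoothFun_ext
  intro u
  have hf : ContDiffAt ℝ ∞ (smoothExt f) (u : ι → ℝ) :=
    (smoothExt_contDiffOn f).contDiffAt (U.isOpen.mem_nhds u.2)
  have hd : DifferentiableAt ℝ (fderiv ℝ (smoothExt f)) (u : ι → ℝ) :=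
    (hf.fderiv_right (m := ∞) (by simp)).differentiableAt (by simp)
  have key : ∀ c d : ι, (partialDeriv c (partialDeriv d f) : U → ℝ) u =
      fderiv ℝ (fderiv ℝ (smoothExt f)) u (Pi.single c 1) (Pi.single d 1) := by
    intro c d
    rw [partialDeriv_apply_of_eq (g := fun v => fderiv ℝ (smoothExt f) v (Pi.single d 1))
      (fun v => rfl), fderiv_clm_apply hd (differentiableAt_const _)]
    simp
  rw [key, key]
  exact (hf.isSymmSndFDerivAt (by
    simpa using (WithTop.coe_le_coe.2 (le_top : (2 : ℕ∞) ≤ ⊤)))).eq _ _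

/-- The primitive is the integral along the c-direction from the hyperplane through a fixed base
point. The base value of the c-coordinate is the same for all points, so integration commutes with
the other partial derivatives; linearity lets the operator pass to the tensor product with the
exterior algebra. -/
theorem exists_primitive (hU : IsBox U) (c : ι) :
    ∃ I : smoothFun U →ₗ[ℝ] smoothFun U, (∀ f, partialDeriv c (I f) = f) ∧
      ∀ a, a ≠ c → ∀ f, partialDeriv a (I f) = I (partialDeriv a f) := by
  rcases (U : Set (ι → ℝ)).eq_empty_or_nonempty with h0 | ⟨u₀, hu₀⟩
  · have : ∀ f g : smoothFun U, f = g := fun f g =>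
      smoothFun_ext fun u => absurd u.2 fun h => by
        have h : (u : ι → ℝ) ∈ (U : Set (ι → ℝ)) := h
        simp [h0] at h
    exact ⟨0, fun _ => this _ _, fun _ _ _ => this _ _⟩
  obtain ⟨J, hJ, hUJ⟩ := hU
  -- The segment in direction c that ends at u for s = 1 and has c-coordinate u₀ c at s = 0. It
  -- stays in U because U is a box.
  let φ : (ι → ℝ) × ℝ → ι → ℝ := fun p => p.1 + ((p.2 - 1) * (p.1 c - u₀ c)) • Pi.single c 1
  have hφ : ContDiff ℝ ∞ φ := by
    have h1 : ContDiff ℝ ∞ fun p : (ι → ℝ) × ℝ => p.1 c :=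
      (contDiff_apply ℝ ℝ c).comp contDiff_fst
    exact contDiff_fst.add (((contDiff_snd.sub contDiff_const).mul
      (h1.sub contDiff_const)).smul contDiff_const)
  have hφU : ∀ u ∈ U, ∀ s ∈ Icc (0 : ℝ) 1, φ (u, s) ∈ U := by
    intro u hu s hs
    change φ (u, s) ∈ (U : Set (ι → ℝ))
    rw [hUJ] at hu₀ ⊢
    have hu : u ∈ Set.univ.pi J := hUJ ▸ hu
    intro a _
    by_cases ha : a = c
    · subst ha
      have hconv : Convex ℝ (J a) := (hJ a).2.convex
      have := hconv (hu₀ a trivial) (hu a trivial) (sub_nonneg.2 hs.2) hs.1 (by ring)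
      convert this using 1
      simp [φ]; ring
    · simpa [φ, ha] using hu a trivial
  -- An open set around U × [0, 1] on which the integrand is smooth, as differentiation under the
  -- integral requires.
  let W : Set ((ι → ℝ) × ℝ) := φ ⁻¹' U
  have hW : IsOpen W := U.isOpen.preimage hφ.continuous
  have hVW : (U : Set (ι → ℝ)) ×ˢ Icc (0 : ℝ) 1 ⊆ W := fun p hp => hφU p.1 hp.1 p.2 hp.2
  have hg : ∀ f : smoothFun U, ContDiffOn ℝ ∞ (fun p => smoothExt f (φ p)) W := fun f =>
    (smoothExt_contDiffOn f).comp hφ.contDiffOn fun p hp => hp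
  have hslice : ∀ (f : smoothFun U), ∀ u ∈ U,
      IntervalIntegrable (fun s => smoothExt f (φ (u, s))) MeasureTheory.volume 0 1 :=
    fun f u hu => ContinuousOn.intervalIntegrable_of_Icc zero_le_one
      ((hg f).continuousOn.comp (by fun_prop) fun s hs => hVW ⟨hu, hs⟩)
  have hsm : ∀ f : smoothFun U, ContDiffOn ℝ ∞
      (fun u : ι → ℝ => (u c - u₀ c) * ∫ s in (0 : ℝ)..1, smoothExt f (φ (u, s))) U := fun f =>
    ((contDiff_apply ℝ ℝ c).sub contDiff_const).contDiffOn.mul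
      (contDiffOn_integral U.isOpen hW hVW (hg f))
  let I : smoothFun U →ₗ[ℝ] smoothFun U :=
    { toFun := fun f => ofContDiffOn U _ (hsm f)
      map_add' := fun f g => by
        apply smoothFun_ext
        intro u
        have h1 : ∫ s in (0 : ℝ)..1, smoothExt (f + g) (φ (u, s)) =
            ∫ s in (0 : ℝ)..1, (smoothExt f (φ (u, s)) + smoothExt g (φ (u, s))) := by
          refine intervalIntegral.integral_congr fun s hs => ?_
          rw [uIcc_of_le zero_le_one] at hs
          have hm := hφU u u.2 s hs
          rw [smoothExt_apply (f + g) ⟨_, hm⟩, smoothExt_apply f ⟨_, hm⟩,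
            smoothExt_apply g ⟨_, hm⟩]
          rfl
        rw [intervalIntegral.integral_add (hslice f u u.2) (hslice g u u.2)] at h1
        change ((u : ι → ℝ) c - u₀ c) * ∫ s in (0 : ℝ)..1, smoothExt (f + g) (φ (u, s)) =
          ((u : ι → ℝ) c - u₀ c) * (∫ s in (0 : ℝ)..1, smoothExt f (φ (u, s))) +
          ((u : ι → ℝ) c - u₀ c) * ∫ s in (0 : ℝ)..1, smoothExt g (φ (u, s))
        rw [h1, mul_add]
      map_smul' := fun r f => by
        apply smoothFun_ext
        intro u
        have h1 : ∫ s in (0 : ℝ)..1, smoothExt (r • f) (φ (u, s)) =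
            ∫ s in (0 : ℝ)..1, (r * smoothExt f (φ (u, s))) := by
          refine intervalIntegral.integral_congr fun s hs => ?_
          rw [uIcc_of_le zero_le_one] at hs
          have hm := hφU u u.2 s hs
          rw [smoothExt_apply (r • f) ⟨_, hm⟩, smoothExt_apply f ⟨_, hm⟩]
          rfl
        rw [intervalIntegral.integral_const_mul] at h1
        change ((u : ι → ℝ) c - u₀ c) * ∫ s in (0 : ℝ)..1, smoothExt (r • f) (φ (u, s)) =
          r * (((u : ι → ℝ) c - u₀ c) * ∫ s in (0 : ℝ)..1, smoothExt f (φ (u, s)))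
        rw [h1]; ring }
  have hId : ∀ (f : smoothFun U) (u : U), (I f : U → ℝ) u =
      ((u : ι → ℝ) c - u₀ c) * ∫ s in (0 : ℝ)..1, smoothExt f (φ (u, s)) := fun _ _ => rfl
  have hφd : ∀ (u v : ι → ℝ) (s r : ℝ), fderiv ℝ φ (u, s) (v, r) =
      v + ((s - 1) * v c + r * (u c - u₀ c)) • Pi.single c 1 := by
    intro u v s r
    have h1 : HasFDerivAt (fun p : (ι → ℝ) × ℝ => p.1 c)
        ((ContinuousLinearMap.proj c).comp (ContinuousLinearMap.fst ℝ (ι → ℝ) ℝ)) (u, s) :=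
      ((ContinuousLinearMap.proj (R := ℝ) (φ := fun _ : ι => ℝ) c).comp
        (ContinuousLinearMap.fst ℝ (ι → ℝ) ℝ)).hasFDerivAt
    have h2 := (hasFDerivAt_fst (𝕜 := ℝ) (p := ((u, s) : (ι → ℝ) × ℝ))).add
      ((((hasFDerivAt_snd (𝕜 := ℝ) (p := ((u, s) : (ι → ℝ) × ℝ))).sub_const 1).mul
        (h1.sub_const (u₀ c))).smul_const (Pi.single c (1 : ℝ) : ι → ℝ))
    have h3 : fderiv ℝ φ (u, s) = _ := h2.fderiv
    rw [h3]
    simp [mul_comm r]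
  have hcomp : ∀ (f : smoothFun U), ∀ u ∈ U, ∀ s ∈ Icc (0 : ℝ) 1,
      HasFDerivAt (fun p => smoothExt f (φ p))
        ((fderiv ℝ (smoothExt f) (φ (u, s))).comp (fderiv ℝ φ (u, s))) (u, s) :=
    fun f u hu s hs => (smoothExt_differentiableAt f ⟨_, hφU u hu s hs⟩).hasFDerivAt.comp
      (u, s) (hφ.contDiffAt.differentiableAt (by simp)).hasFDerivAt
  have hpd : ∀ (a : ι) (f : smoothFun U) (u : U), (partialDeriv a (I f) : U → ℝ) u =
      (if a = c then 1 else 0) * (∫ s in (0 : ℝ)..1, smoothExt f (φ (u, s))) +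
      ((u : ι → ℝ) c - u₀ c) * ∫ s in (0 : ℝ)..1, (fderiv ℝ (smoothExt f) (φ (u, s))
        (Pi.single a 1 + ((s - 1) * (Pi.single a 1 : ι → ℝ) c) • Pi.single c 1)) := by
    intro a f u
    rw [partialDeriv_apply_of_eq (g := fun u => (u c - u₀ c) * ∫ s in (0 : ℝ)..1,
      smoothExt f (φ (u, s))) (hId f) u]
    have h1 : HasFDerivAt (fun v : ι → ℝ => v c - u₀ c) (ContinuousLinearMap.proj c)
        (u : ι → ℝ) :=
      ((ContinuousLinearMap.proj (R := ℝ) (φ := fun _ : ι => ℝ) c).hasFDerivAt).sub_const _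
    have h2 := hasFDerivAt_integral_of_contDiffOn U.isOpen hW hVW (hg f) u.2
    have hint : IntervalIntegrable (fun s => (fderiv ℝ (fun p => smoothExt f (φ p)) (u, s)).comp
        (ContinuousLinearMap.inl ℝ (ι → ℝ) ℝ)) MeasureTheory.volume 0 1 := by
      refine ContinuousOn.intervalIntegrable_of_Icc zero_le_one ?_
      have hc := (((hg f).fderiv_of_isOpen hW (m := ∞) (by simp)).clm_comp
        (contDiffOn_const (c := ContinuousLinearMap.inl ℝ (ι → ℝ) ℝ))).continuousOn
      exact hc.comp (f := fun s : ℝ => ((u : ι → ℝ), s)) (by fun_prop)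
        fun s hs => hVW ⟨u.2, hs⟩
    rw [(h1.fun_mul h2).fderiv]
    simp only [add_apply, smul_apply, smul_eq_mul,
      ContinuousLinearMap.proj_apply]
    rw [ContinuousLinearMap.intervalIntegral_apply hint, add_comm]
    congr 1
    · rw [mul_comm]
      congr 1
      simp [Pi.single_apply, eq_comm]
    · congr 1
      refine intervalIntegral.integral_congr fun s hs => ?_
      rw [uIcc_of_le zero_le_one] at hs
      rw [(hcomp f u u.2 s hs).fderiv]
      simp [hφd]
  refine ⟨I, fun f => smoothFun_ext fun u => ?_, fun a ha f => smoothFun_ext fun u => ?_⟩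
  -- The derivative of s ↦ s f(φ(u, s)) is the integrand of ∂_c (I f), so the fundamental theorem of
  -- calculus returns f(φ(u, 1)) = f(u).
  · have hder : ∀ s ∈ uIcc (0 : ℝ) 1, HasDerivAt (fun s => s * smoothExt f (φ (u, s)))
        (1 * smoothExt f (φ (u, s)) + s * (((u : ι → ℝ) c - u₀ c) *
          fderiv ℝ (smoothExt f) (φ (u, s)) (Pi.single c 1))) s := by
      intro s hs
      rw [uIcc_of_le zero_le_one] at hs
      refine (hasDerivAt_id' s).mul ?_
      have := (hcomp f u u.2 s hs).comp_hasDerivAt s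
        ((hasDerivAt_const s (u : ι → ℝ)).prodMk (hasDerivAt_id' s))
      exact this.congr_deriv (by simp [hφd])
    have hci : ContinuousOn (fun s => fderiv ℝ (smoothExt f) (φ (u, s)) (Pi.single c 1))
        (Icc (0 : ℝ) 1) := by
      have : ContinuousOn (fun v => fderiv ℝ (smoothExt f) v (Pi.single c 1)) U :=
        (((smoothExt_contDiffOn f).fderiv_of_isOpen U.isOpen (m := ∞)
          (by simp)).clm_apply contDiffOn_const).continuousOn
      exact this.comp (f := fun s : ℝ => φ (u, s)) (by
        have := hφ.continuous
        fun_prop) fun s hs => hφU u u.2 s hs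
    have hi2 : IntervalIntegrable (fun s : ℝ => s * (((u : ι → ℝ) c - u₀ c) *
          fderiv ℝ (smoothExt f) (φ (u, s)) (Pi.single c 1))) MeasureTheory.volume 0 1 :=
      ContinuousOn.intervalIntegrable_of_Icc zero_le_one
        (continuousOn_id.mul (continuousOn_const.mul hci))
    have hi1 : IntervalIntegrable (fun s : ℝ => 1 * smoothExt f (φ (u, s)))
        MeasureTheory.volume 0 1 := (hslice f u u.2).const_mul 1
    have hftc := intervalIntegral.integral_eq_sub_of_hasDerivAt hder (hi1.add hi2)
    rw [intervalIntegral.integral_add hi1 hi2] at hftc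
    have hend : φ (u, 1) = u := by simp [φ]
    rw [hpd c f u]
    simp only [one_mul, hend, zero_mul, sub_zero] at hftc
    rw [smoothExt_apply] at hftc
    rw [← hftc]
    simp only [if_true, one_mul]
    congr 1
    rw [← intervalIntegral.integral_const_mul]
    congr 1
    funext s
    simp
    ring
  · rw [hpd a f u, hId, if_neg ha, zero_mul, zero_add]
    congr 1
    refine intervalIntegral.integral_congr fun s hs => ?_
    rw [uIcc_of_le zero_le_one] at hs
    rw [smoothExt_apply (partialDeriv a f) ⟨_, hφU u u.2 s hs⟩, partialDeriv_apply]
    simp [Ne.symm ha]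

end SmoothFun
/-! ### Signs -/

theorem sgn_zero : sgn 0 = 1 := by simp [sgn]

theorem sgn_one : sgn 1 = -1 := by simp [sgn]

theorem zmod2_cases (p : ZMod 2) : p = 0 ∨ p = 1 := by
  revert p; decide

theorem zmod2_eq_one {p : ZMod 2} (h : ¬ p = 0) : p = 1 :=
  (zmod2_cases p).resolve_left h

theorem zmod2_add_self (p : ZMod 2) : p + p = 0 := by
  revert p; decide

theorem sgn_mul_sgn (p q : ZMod 2) : sgn p * sgn q = sgn (p + q) := by
  have h : (1 + 1 : ZMod 2) = 0 := by decide
  rcases zmod2_cases p with rfl | rfl <;> rcases zmod2_cases q with rfl | rfl <;>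
    simp [sgn, h]

theorem sgn_mul_self (p : ZMod 2) : sgn p * sgn p = 1 := by
  rw [sgn_mul_sgn, zmod2_add_self, sgn_zero]

theorem sgn_ne_zero (p : ZMod 2) : sgn p ≠ 0 := fun h => by
  simpa [h] using sgn_mul_self p

theorem sgn_smul_sgn_smul {M : Type} [AddCommGroup M] [Module ℝ M] (p q : ZMod 2) (m : M) :
    sgn p • sgn q • m = sgn (p + q) • m := by
  rw [smul_smul, sgn_mul_sgn]

theorem neg_sgn (p : ZMod 2) : -sgn p = sgn (p + 1) := by
  rw [← sgn_mul_sgn, sgn_one]; ring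

theorem neg_sgn_smul {M : Type} [AddCommGroup M] [Module ℝ M] (p : ZMod 2) (m : M) :
    -(sgn p • m) = sgn (p + 1) • m := by
  rw [← neg_sgn, neg_smul]

/-! ### Exterior algebra -/

section Exterior

variable {M : Type} [AddCommGroup M] [Module ℝ M]

open CliffordAlgebra

theorem contractLeft_mul (d : Module.Dual ℝ M) (a b : ExteriorAlgebra ℝ M) :
    contractLeft (Q := (0 : QuadraticForm ℝ M)) d (a * b) =
      contractLeft (Q := (0 : QuadraticForm ℝ M)) d a * b +
        involute (Q := (0 : QuadraticForm ℝ M)) a *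
          contractLeft (Q := (0 : QuadraticForm ℝ M)) d b := by
  induction a using CliffordAlgebra.left_induction with
  | algebraMap r => simp [contractLeft_algebraMap_mul, contractLeft_algebraMap]
  | add x y hx hy => simp only [add_mul, map_add, hx, hy]; abel
  | ι_mul x m hx =>
    rw [mul_assoc, contractLeft_ι_mul, hx, contractLeft_ι_mul, map_mul, involute_ι]
    simp only [mul_add, sub_mul, smul_mul_assoc, neg_mul, mul_assoc]
    abel

theorem involute_contractLeft (d : Module.Dual ℝ M) (a : ExteriorAlgebra ℝ M) :
    involute (Q := (0 : QuadraticForm ℝ M)) (contractLeft (Q := (0 : QuadraticForm ℝ M)) d a) =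
      -contractLeft (Q := (0 : QuadraticForm ℝ M)) d
        (involute (Q := (0 : QuadraticForm ℝ M)) a) := by
  induction a using CliffordAlgebra.left_induction with
  | algebraMap r => simp [contractLeft_algebraMap]
  | add x y hx hy => simp only [map_add, hx, hy]; abel
  | ι_mul x m hx =>
    rw [contractLeft_ι_mul, map_mul, involute_ι, map_sub, map_mul, hx, involute_ι, neg_mul,
      neg_mul, map_neg, contractLeft_ι_mul, map_smul]
    simp

/-- Moving a generator from the left end to the right end of a product of k generators passes k - 1
others, and (-1)^(k-1) is the action of the involution on the remaining factor. -/
theorem contractRight_eq_involute (d : Module.Dual ℝ M) (a : ExteriorAlgebra ℝ M) :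
    contractRight (Q := (0 : QuadraticForm ℝ M)) a d =
      involute (Q := (0 : QuadraticForm ℝ M))
        (contractLeft (Q := (0 : QuadraticForm ℝ M)) d a) := by
  induction a using CliffordAlgebra.right_induction with
  | algebraMap r => simp [contractLeft_algebraMap, contractRight_algebraMap]
  | add x y hx hy => simp only [map_add, LinearMap.add_apply, hx, hy]
  | mul_ι m x hx =>
    rw [contractRight_mul_ι, hx]
    have := contractLeft_mul d x (ι (0 : QuadraticForm ℝ M) m)
    rw [this, map_add, map_mul, map_mul, involute_ι, involute_involute, contractLeft_ι,
      AlgHom.commutes, ← Algebra.commutes, ← Algebra.smul_def]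
    simp only [mul_neg]
    abel

theorem ι_mul_eq_involute_mul_ι (m : M) (a : ExteriorAlgebra ℝ M) :
    ExteriorAlgebra.ι ℝ m * a =
      involute (Q := (0 : QuadraticForm ℝ M)) a * ExteriorAlgebra.ι ℝ m := by
  induction a using CliffordAlgebra.left_induction with
  | algebraMap r => rw [AlgHom.commutes, Algebra.commutes]
  | add x y hx hy => simp only [map_add, mul_add, add_mul, hx, hy]
  | ι_mul x k hx =>
    rw [map_mul, involute_ι, mul_assoc, ← hx, ← mul_assoc, ← mul_assoc]
    congr 1
    have := ExteriorAlgebra.ι_add_mul_swap (R := ℝ) m k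
    rw [neg_mul]
    exact eq_neg_of_add_eq_zero_left this

end Exterior

/-! ### The superalgebra of superfunctions -/

section SuperAlgebra

variable {ι : Type} [Fintype ι] {par : ι → ZMod 2}
  {U : TopologicalSpace.Opens (EvenSpace par)}

instance : Ring (SuperFun U) := Algebra.TensorProduct.instRing

instance : Algebra ℝ (SuperFun U) := Algebra.TensorProduct.leftAlgebra

theorem parityAut_tmul (s : smoothFun U) (w : ExteriorAlgebra ℝ (OddSpace par)) :
    parityAut (s ⊗ₜ[ℝ] w : SuperFun U) =
      s ⊗ₜ[ℝ] CliffordAlgebra.involute (Q := (0 : QuadraticForm ℝ (OddSpace par))) w := rfl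

theorem parityAut_one : parityAut (1 : SuperFun U) = 1 := by
  rw [Algebra.TensorProduct.one_def, parityAut_tmul, map_one]

theorem parityAut_mul (f g : SuperFun U) : parityAut (f * g) = parityAut f * parityAut g := by
  induction f using TensorProduct.induction_on with
  | zero => simp
  | add x y hx hy => simp only [add_mul, map_add, hx, hy]
  | tmul s w =>
    induction g using TensorProduct.induction_on with
    | zero => simp
    | add x y hx hy => simp only [mul_add, map_add, hx, hy]
    | tmul t v =>
      simp only [Algebra.TensorProduct.tmul_mul_tmul, parityAut_tmul, map_mul]

theorem parityAut_parityAut (f : SuperFun U) : parityAut (parityAut f) = f := by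
  induction f using TensorProduct.induction_on with
  | zero => simp
  | add x y hx hy => simp only [map_add, hx, hy]
  | tmul s w => simp only [parityAut_tmul, CliffordAlgebra.involute_involute]

theorem tmul_one_mul_comm (s : smoothFun U) (g : SuperFun U) :
    (s ⊗ₜ[ℝ] 1 : SuperFun U) * g = g * s ⊗ₜ[ℝ] 1 := by
  induction g using TensorProduct.induction_on with
  | zero => simp
  | add x y hx hy => simp only [mul_add, add_mul, hx, hy]
  | tmul t v => simp [Algebra.TensorProduct.tmul_mul_tmul, mul_comm s t]

theorem ι_mul_eq_parityAut_mul (m : OddSpace par) (g : SuperFun U) :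
    (1 ⊗ₜ[ℝ] ExteriorAlgebra.ι ℝ m : SuperFun U) * g =
      parityAut g * 1 ⊗ₜ[ℝ] ExteriorAlgebra.ι ℝ m := by
  induction g using TensorProduct.induction_on with
  | zero => simp
  | add x y hx hy => simp only [mul_add, add_mul, map_add, hx, hy]
  | tmul t v =>
    simp only [Algebra.TensorProduct.tmul_mul_tmul, parityAut_tmul, one_mul, mul_one,
      ι_mul_eq_involute_mul_ι]

/-- An induction principle: superfunctions are generated by smooth functions and odd
coordinates. -/
theorem superFun_induction {P : SuperFun U → Prop} (h₀ : ∀ s : smoothFun U, P (s ⊗ₜ[ℝ] 1))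
    (h₁ : ∀ m : OddSpace par, P (1 ⊗ₜ[ℝ] ExteriorAlgebra.ι ℝ m))
    (hadd : ∀ f g, P f → P g → P (f + g)) (hmul : ∀ f g, P f → P g → P (f * g))
    (f : SuperFun U) : P f := by
  induction f using TensorProduct.induction_on with
  | zero => simpa using h₀ 0
  | add x y hx hy => exact hadd x y hx hy
  | tmul s w =>
    have hw : P (1 ⊗ₜ[ℝ] w) := by
      induction w using ExteriorAlgebra.induction with
      | algebraMap r =>
        have := h₀ (algebraMap ℝ _ r)
        rwa [Algebra.algebraMap_eq_smul_one, TensorProduct.smul_tmul,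
          ← Algebra.algebraMap_eq_smul_one] at this
      | ι m => exact h₁ m
      | mul a b ha hb =>
        have := hmul _ _ ha hb
        rwa [Algebra.TensorProduct.tmul_mul_tmul, one_mul] at this
      | add a b ha hb => rw [TensorProduct.tmul_add]; exact hadd _ _ ha hb
    have := hmul _ _ (h₀ s) hw
    rwa [Algebra.TensorProduct.tmul_mul_tmul, one_mul, mul_one] at this

theorem mul_comm_of_even {g : SuperFun U} (hg : HasParity g 0) (f : SuperFun U) :
    f * g = g * f := by
  rw [HasParity, sgn_zero, one_smul] at hg
  induction f using superFun_induction with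
  | h₀ s => exact tmul_one_mul_comm s g
  | h₁ m => rw [ι_mul_eq_parityAut_mul, hg]
  | hadd f k hf hk => rw [add_mul, mul_add, hf, hk]
  | hmul f k hf hk => rw [mul_assoc, hk, ← mul_assoc, hf, mul_assoc]

/-- With g fixed, the elements f that satisfy the identity are closed under sums and products, so
generators suffice. -/
theorem mul_comm_of_odd {g : SuperFun U} (hg : HasParity g 1) (f : SuperFun U) :
    f * g = g * parityAut f := by
  have hg : parityAut g = -g := by rw [hg, sgn_one]; exact neg_one_smul ℝ g
  induction f using superFun_induction with
  | h₀ s => rw [parityAut_tmul, map_one]; exact tmul_one_mul_comm s g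
  | h₁ m =>
    rw [ι_mul_eq_parityAut_mul, hg, parityAut_tmul, CliffordAlgebra.involute_ι,
      TensorProduct.tmul_neg]
    exact (neg_mul_comm _ _)
  | hadd f k hf hk => rw [add_mul, map_add, mul_add, hf, hk]
  | hmul f k hf hk => rw [mul_assoc, hk, ← mul_assoc, hf, mul_assoc, parityAut_mul]

/-- Superfunctions supercommute. -/
theorem mul_comm_of_hasParity {f g : SuperFun U} {p q : ZMod 2} (hf : HasParity f p)
    (hg : HasParity g q) : f * g = sgn (p * q) • (g * f) := by
  rcases zmod2_cases q with rfl | rfl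
  · rw [mul_comm_of_even hg, mul_zero, sgn_zero, one_smul]
  · rw [mul_comm_of_odd hg, hf, mul_one, mul_smul_comm]

/-! ### Partial derivatives -/

variable [DecidableEq ι]

theorem leftD_tmul_of_even {A : ι} (h : par A = 0) (s : smoothFun U)
    (w : ExteriorAlgebra ℝ (OddSpace par)) :
    leftD A (s ⊗ₜ[ℝ] w : SuperFun U) = partialDeriv ⟨A, h⟩ s ⊗ₜ[ℝ] w := by
  rw [leftD, dif_pos h]; rfl

theorem leftD_tmul_of_odd {A : ι} (h : ¬ par A = 0) (s : smoothFun U)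
    (w : ExteriorAlgebra ℝ (OddSpace par)) :
    leftD A (s ⊗ₜ[ℝ] w : SuperFun U) =
      s ⊗ₜ[ℝ] CliffordAlgebra.contractLeft (Q := (0 : QuadraticForm ℝ (OddSpace par)))
        (LinearMap.proj ⟨A, h⟩) w := by
  rw [leftD, dif_neg h]; rfl

theorem parityAut_leftD (A : ι) (f : SuperFun U) :
    parityAut (leftD A f) = sgn (par A) • leftD A (parityAut f) := by
  induction f using TensorProduct.induction_on with
  | zero => simp
  | add x y hx hy => simp only [map_add, smul_add, hx, hy]
  | tmul s w =>
    by_cases h : par A = 0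
    · simp only [leftD_tmul_of_even h, parityAut_tmul, h, sgn_zero, one_smul]
    · rw [leftD_tmul_of_odd h, parityAut_tmul, parityAut_tmul, leftD_tmul_of_odd h,
        zmod2_eq_one h, sgn_one, involute_contractLeft, TensorProduct.tmul_neg]
      exact (neg_one_smul ℝ _).symm

theorem leftD_mul_of_even {A : ι} (h : par A = 0) (f g : SuperFun U) :
    leftD A (f * g) = leftD A f * g + f * leftD A g := by
  induction f using TensorProduct.induction_on with
  | zero => simp
  | add x y hx hy => simp only [add_mul, map_add, hx, hy]; abel
  | tmul s w =>
    induction g using TensorProduct.induction_on with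
    | zero => simp
    | add x y hx hy => simp only [mul_add, map_add, hx, hy]; abel
    | tmul t v =>
      simp only [Algebra.TensorProduct.tmul_mul_tmul, leftD_tmul_of_even h, partialDeriv_mul,
        TensorProduct.add_tmul]

theorem leftD_mul_of_odd {A : ι} (h : ¬ par A = 0) (f g : SuperFun U) :
    leftD A (f * g) = leftD A f * g + parityAut f * leftD A g := by
  induction f using TensorProduct.induction_on with
  | zero => simp
  | add x y hx hy => simp only [add_mul, map_add, hx, hy]; abel
  | tmul s w =>
    induction g using TensorProduct.induction_on with
    | zero => simp
    | add x y hx hy => simp only [mul_add, map_add, hx, hy]; abel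
    | tmul t v =>
      simp only [Algebra.TensorProduct.tmul_mul_tmul, leftD_tmul_of_odd h, parityAut_tmul,
        contractLeft_mul, TensorProduct.tmul_add]

/-- The graded Leibniz rule for left derivatives. -/
theorem leftD_mul (A : ι) {f : SuperFun U} {p : ZMod 2} (hf : HasParity f p) (g : SuperFun U) :
    leftD A (f * g) = leftD A f * g + sgn (par A * p) • (f * leftD A g) := by
  by_cases h : par A = 0
  · rw [leftD_mul_of_even h, h, zero_mul, sgn_zero, one_smul]
  · rw [leftD_mul_of_odd h, zmod2_eq_one h, one_mul, hf, smul_mul_assoc]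

theorem leftD_comm (A B : ι) (f : SuperFun U) :
    leftD A (leftD B f) = sgn (par A * par B) • leftD B (leftD A f) := by
  induction f using TensorProduct.induction_on with
  | zero => simp
  | add x y hx hy => simp only [map_add, smul_add, hx, hy]
  | tmul s w =>
    by_cases hA : par A = 0 <;> by_cases hB : par B = 0
    · simp only [leftD_tmul_of_even hA, leftD_tmul_of_even hB, hA, zero_mul, sgn_zero, one_smul]
      rw [partialDeriv_comm]
    · simp only [leftD_tmul_of_even hA, leftD_tmul_of_odd hB, hA, zero_mul, sgn_zero, one_smul]
    · simp only [leftD_tmul_of_even hB, leftD_tmul_of_odd hA, hB, mul_zero, sgn_zero, one_smul]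
    · rw [leftD_tmul_of_odd hB, leftD_tmul_of_odd hA, leftD_tmul_of_odd hA,
        leftD_tmul_of_odd hB, zmod2_eq_one hA, zmod2_eq_one hB,
        mul_one, sgn_one, CliffordAlgebra.contractLeft_comm, TensorProduct.tmul_neg]
      exact (neg_one_smul ℝ _).symm

theorem rightD_eq (A : ι) {f : SuperFun U} {p : ZMod 2} (hf : HasParity f p) :
    rightD A f = sgn (par A * (p + 1)) • leftD A f := by
  by_cases h : par A = 0
  · rw [rightD, leftD, dif_pos h, dif_pos h, h, zero_mul, sgn_zero, one_smul]
  · have key : ∀ g : SuperFun U, rightD A g = parityAut (leftD A g) := by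
      intro g
      induction g using TensorProduct.induction_on with
      | zero => simp
      | add x y hx hy => simp only [map_add, hx, hy]
      | tmul s w =>
        rw [leftD_tmul_of_odd h, parityAut_tmul, ← contractRight_eq_involute, rightD,
          dif_neg h]
        rfl
    rw [key, parityAut_leftD, hf, map_smul, smul_smul, zmod2_eq_one h, one_mul, sgn_mul_sgn,
      add_comm]

theorem leftD_one (A : ι) : leftD A (1 : SuperFun U) = 0 := by
  rw [Algebra.TensorProduct.one_def]
  by_cases h : par A = 0
  · rw [leftD_tmul_of_even h, partialDeriv_one, TensorProduct.zero_tmul]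
  · rw [leftD_tmul_of_odd h, CliffordAlgebra.contractLeft_one, TensorProduct.tmul_zero]

theorem leftD_coord (A B : ι) : leftD A (coord U B) = if A = B then 1 else 0 := by
  have e0 := CliffordAlgebra.contractLeft_one (Q := (0 : QuadraticForm ℝ (OddSpace par)))
  by_cases hA : par A = 0 <;> by_cases hB : par B = 0
  · rw [coord, dif_pos hB, leftD_tmul_of_even hA, partialDeriv_coordFun]
    by_cases h : A = B
    · simp [h, Algebra.TensorProduct.one_def]
    · simp [h]
  · rw [coord, dif_neg hB, leftD_tmul_of_even hA, partialDeriv_one, TensorProduct.zero_tmul,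
      if_neg]
    rintro rfl; exact hB hA
  · rw [coord, dif_pos hB, leftD_tmul_of_odd hA, e0, TensorProduct.tmul_zero, if_neg]
    rintro rfl; exact hA hB
  · rw [coord, dif_neg hB, leftD_tmul_of_odd hA, CliffordAlgebra.contractLeft_ι]
    by_cases h : A = B
    · subst h; simp [Algebra.TensorProduct.one_def]
    · simp [h]

theorem hasParity_coord (A : ι) : HasParity (coord U A) (par A) := by
  rw [HasParity, coord]
  by_cases h : par A = 0
  · rw [dif_pos h, parityAut_tmul, map_one, h, sgn_zero, one_smul]
  · rw [dif_neg h, parityAut_tmul, CliffordAlgebra.involute_ι, zmod2_eq_one h, sgn_one,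
      TensorProduct.tmul_neg]
    exact (neg_one_smul ℝ _).symm

/-! ### The Poincaré lemma -/

/-- A superfunction that does not depend on some of the coordinates other than `Γ^C` has a
primitive along `Γ^C` that does not depend on them either. -/
theorem exists_leftD_eq (hU : IsBox U) (C : ι) (S : Finset ι) (hC : C ∉ S) {f : SuperFun U}
    (hf : HasParity f (par C)) (hfC : par C ≠ 0 → leftD C f = 0)
    (hfS : ∀ A ∈ S, leftD A f = 0) :
    ∃ g : SuperFun U, HasParity g 0 ∧ leftD C g = f ∧ ∀ A ∈ S, leftD A g = 0 := by
  by_cases h : par C = 0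
  -- Even coordinate: integrate the smooth factor.
  · obtain ⟨I, hI, hIc⟩ := exists_primitive hU (⟨C, h⟩ : {A // par A = 0})
    have hpar : ∀ f : SuperFun U, parityAut (I.rTensor _ f) = I.rTensor _ (parityAut f) := by
      intro f
      induction f using TensorProduct.induction_on with
      | zero => simp
      | add x y hx hy => simp only [map_add, hx, hy]
      | tmul s w => simp only [LinearMap.rTensor_tmul, parityAut_tmul]
    have hder : ∀ f : SuperFun U, leftD C (I.rTensor _ f) = f := by
      intro f
      induction f using TensorProduct.induction_on with
      | zero => simp
      | add x y hx hy => simp only [map_add, hx, hy]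
      | tmul s w => rw [LinearMap.rTensor_tmul, leftD_tmul_of_even h, hI]
    have hcomm : ∀ A ∈ S, ∀ f : SuperFun U,
        leftD A (I.rTensor _ f) = I.rTensor _ (leftD A f) := by
      intro A hA f
      have hne : A ≠ C := fun e => hC (e ▸ hA)
      induction f using TensorProduct.induction_on with
      | zero => simp
      | add x y hx hy => simp only [map_add, hx, hy]
      | tmul s w =>
        by_cases hA' : par A = 0
        · rw [LinearMap.rTensor_tmul, leftD_tmul_of_even hA', leftD_tmul_of_even hA',
            LinearMap.rTensor_tmul, hIc _ fun e => hne (congrArg Subtype.val e)]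
        · rw [LinearMap.rTensor_tmul, leftD_tmul_of_odd hA', leftD_tmul_of_odd hA',
            LinearMap.rTensor_tmul]
    refine ⟨I.rTensor _ f, ?_, hder f, fun A hA => ?_⟩
    · rw [HasParity, hpar, hf, map_smul, h]
    · rw [hcomm A hA, hfS A hA, map_zero]
  -- Odd coordinate θ: ∂_θ(θ f) = f - θ ∂_θ f, and the last term vanishes by hypothesis.
  · refine ⟨coord U C * f, by
      rw [HasParity, parityAut_mul, hasParity_coord, hf, smul_mul_smul_comm, sgn_mul_self,
        sgn_zero], ?_,
      fun A hA => ?_⟩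
    · rw [leftD_mul C (hasParity_coord C), hfC h, leftD_coord, if_pos rfl]
      simp
    · rw [leftD_mul A (hasParity_coord C), hfS A hA, leftD_coord,
        if_neg fun e : A = C => hC (e ▸ hA)]
      simp

end SuperAlgebra
/-! ### Calculus on an abstract supercommutative algebra -/

/-- A supercommutative algebra with coordinates, in which the Poincaré lemma holds along each
coordinate. -/
structure SuperCalculus {ι : Type} [Fintype ι] [DecidableEq ι] (par : ι → ZMod 2) (A : Type)
    [Ring A] [Algebra ℝ A] where
  /-- The parity automorphism. -/
  σ : A →ₗ[ℝ] A
  /-- The left partial derivatives. -/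
  D : ι → A →ₗ[ℝ] A
  /-- The right partial derivatives. -/
  Dr : ι → A →ₗ[ℝ] A
  /-- The coordinates. -/
  Γ : ι → A
  σ_one : σ 1 = 1
  σ_mul : ∀ f g, σ (f * g) = σ f * σ g
  σ_σ : ∀ f, σ (σ f) = f
  mul_comm' : ∀ f g p q, σ f = sgn p • f → σ g = sgn q • g → f * g = sgn (p * q) • (g * f)
  σ_D : ∀ a f, σ (D a f) = sgn (par a) • D a (σ f)
  D_mul' : ∀ a f p g, σ f = sgn p • f → D a (f * g) = D a f * g + sgn (par a * p) • (f * D a g)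
  D_comm : ∀ a b f, D a (D b f) = sgn (par a * par b) • D b (D a f)
  Dr_eq' : ∀ a f p, σ f = sgn p • f → Dr a f = sgn (par a * (p + 1)) • D a f
  D_one : ∀ a, D a 1 = 0
  D_Γ : ∀ a b, D a (Γ b) = if a = b then 1 else 0
  σ_Γ : ∀ a, σ (Γ a) = sgn (par a) • Γ a
  exists_D_eq' : ∀ (c : ι) (S : Finset ι), c ∉ S → ∀ f, σ f = sgn (par c) • f →
    (par c ≠ 0 → D c f = 0) → (∀ a ∈ S, D a f = 0) →
    ∃ g, σ g = sgn 0 • g ∧ D c g = f ∧ ∀ a ∈ S, D a g = 0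

namespace SuperCalculus

section Basic

variable {ι : Type} [Fintype ι] [DecidableEq ι] {par : ι → ZMod 2} {A : Type}
    [Ring A] [Algebra ℝ A] (C : SuperCalculus par A)

/-- `f` is homogeneous of parity `p`. -/
def HasParity (f : A) (p : ZMod 2) : Prop := C.σ f = sgn p • f

/-- The homogeneous component of `f` of parity `p`. -/
def parityPart (p : ZMod 2) (f : A) : A := (1 / 2 : ℝ) • (f + sgn p • C.σ f)

variable {C}

theorem HasParity.zero (p : ZMod 2) : C.HasParity 0 p := by
  simp [HasParity]

theorem HasParity.one : C.HasParity 1 0 := by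
  simp [HasParity, C.σ_one, sgn_zero]

theorem HasParity.add {f g : A} {p : ZMod 2} (hf : C.HasParity f p)
    (hg : C.HasParity g p) : C.HasParity (f + g) p := by
  rw [HasParity] at *
  rw [map_add, hf, hg, smul_add]

theorem HasParity.smul {f : A} {p : ZMod 2} (hf : C.HasParity f p) (r : ℝ) :
    C.HasParity (r • f) p := by
  rw [HasParity] at *
  rw [map_smul, hf, smul_comm]

theorem HasParity.sub {f g : A} {p : ZMod 2} (hf : C.HasParity f p)
    (hg : C.HasParity g p) : C.HasParity (f - g) p := by
  rw [HasParity] at *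
  rw [map_sub, hf, hg, smul_sub]

theorem HasParity.sum {κ : Type} {s : Finset κ} {f : κ → A} {p : ZMod 2}
    (hf : ∀ k ∈ s, C.HasParity (f k) p) : C.HasParity (∑ k ∈ s, f k) p := by
  rw [HasParity, map_sum, Finset.smul_sum]
  exact Finset.sum_congr rfl hf

theorem HasParity.mul {f g : A} {p q : ZMod 2} (hf : C.HasParity f p)
    (hg : C.HasParity g q) : C.HasParity (f * g) (p + q) := by
  rw [HasParity] at *
  rw [C.σ_mul, hf, hg, smul_mul_smul_comm, sgn_mul_sgn]

theorem HasParity.congr {f : A} {p q : ZMod 2} (hf : C.HasParity f p)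
    (h : p = q) : C.HasParity f q := h ▸ hf

theorem HasParity.D {f : A} {p : ZMod 2} (hf : C.HasParity f p) (a : ι) :
    C.HasParity (C.D a f) (p + par a) := by
  rw [HasParity, C.σ_D, hf, map_smul, sgn_smul_sgn_smul, add_comm]

theorem HasParity.mul_comm {f g : A} {p q : ZMod 2} (hf : C.HasParity f p)
    (hg : C.HasParity g q) : f * g = sgn (p * q) • (g * f) :=
  C.mul_comm' f g p q hf hg

theorem D_mul (a : ι) {f : A} {p : ZMod 2} (hf : C.HasParity f p) (g : A) :
    C.D a (f * g) = C.D a f * g + sgn (par a * p) • (f * C.D a g) :=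
  C.D_mul' a f p g hf

theorem Dr_eq (a : ι) {f : A} {p : ZMod 2} (hf : C.HasParity f p) :
    C.Dr a f = sgn (par a * (p + 1)) • C.D a f :=
  C.Dr_eq' a f p hf

theorem hasParity_Γ (a : ι) : C.HasParity (C.Γ a) (par a) := C.σ_Γ a

theorem hasParity_parityPart (p : ZMod 2) (f : A) : C.HasParity (C.parityPart p f) p := by
  rw [HasParity, parityPart, map_smul, map_add, map_smul, C.σ_σ, smul_comm,
    smul_add (sgn p), smul_smul (sgn p), sgn_mul_self, one_smul, add_comm]

theorem parityPart_add_parityPart (f : A) : C.parityPart 0 f + C.parityPart 1 f = f := by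
  rw [parityPart, parityPart, sgn_zero, sgn_one]
  module

theorem parityPart_self {f : A} {p : ZMod 2} (hf : C.HasParity f p) :
    C.parityPart p f = f := by
  rw [parityPart, hf, smul_smul, sgn_mul_self]
  module

theorem parityPart_of_ne {f : A} {p q : ZMod 2} (hf : C.HasParity f p) (h : q ≠ p) :
    C.parityPart q f = 0 := by
  have hq : ∀ p q : ZMod 2, q ≠ p → q + p = 1 := by decide
  rw [parityPart, hf, smul_smul, sgn_mul_sgn, hq p q h, sgn_one]
  simp

@[elab_as_elim]
theorem homogeneous_induction {P : A → Prop}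
    (h : ∀ (p : ZMod 2) (f : A), C.HasParity f p → P f)
    (hadd : ∀ f g, P f → P g → P (f + g)) (f : A) : P f := by
  rw [← C.parityPart_add_parityPart f]
  exact hadd _ _ (h _ _ (hasParity_parityPart _ _)) (h _ _ (hasParity_parityPart _ _))

/-- The Poincaré lemma for one-forms in some of the coordinates. -/
theorem exists_potential (S : Finset ι) (Φ : ι → A)
    (hΦ : ∀ a, C.HasParity (Φ a) (par a))
    (hclosed : ∀ a ∈ S, ∀ b ∈ S, C.D a (Φ b) = sgn (par a * par b) • C.D b (Φ a)) :
    ∃ h : A, C.HasParity h 0 ∧ ∀ a ∈ S, C.D a h = Φ a := by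
  induction S using Finset.induction_on with
  | empty => exact ⟨0, HasParity.zero 0, by simp⟩
  | insert c S hc ih =>
    obtain ⟨k, hk, hkS⟩ := ih fun a ha b hb =>
      hclosed a (Finset.mem_insert_of_mem ha) b (Finset.mem_insert_of_mem hb)
    -- The potential k for S is corrected by a primitive of Φ_c - ∂_c k along c. Closedness makes
    -- this residue independent of the coordinates in S, so the correction does not spoil them. For
    -- odd c, closedness of the pair (c, c) reads ∂_c Φ_c = -∂_c Φ_c, which supplies the extra
    -- condition.
    obtain ⟨g, hg, hgc, hgS⟩ := C.exists_D_eq' c S hc (Φ c - C.D c k)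
      ((hΦ c).sub ((hk.D c).congr (zero_add _))) (fun hc' => by
        have h1 := hclosed c (Finset.mem_insert_self c S) c (Finset.mem_insert_self c S)
        have h2 := C.D_comm c c k
        rw [zmod2_eq_one hc', mul_one, sgn_one, neg_smul, one_smul] at h1 h2
        have h0 : ∀ x : A, x = -x → x = 0 := fun x hx => by
          have : (2 : ℝ) • x = 0 := by linear_combination (norm := module) (1 : ℝ) • hx
          simpa using this
        rw [map_sub, h0 _ h1, h0 _ h2, sub_zero]) (fun a ha => by
        rw [map_sub, hclosed a (Finset.mem_insert_of_mem ha) c (Finset.mem_insert_self c S),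
          ← hkS a ha, ← C.D_comm, sub_self])
    refine ⟨k + g, hk.add hg, fun a ha => ?_⟩
    rcases Finset.mem_insert.1 ha with rfl | ha
    · rw [map_add, hgc, add_sub_cancel]
    · rw [map_add, hgS a ha, hkS a ha, add_zero]

variable (C)

/-- The axioms of an antibracket. -/
structure IsAntibracket (B : A → A → A) : Prop where
  add_left : ∀ F G H, B (F + G) H = B F H + B G H
  smul_left : ∀ (r : ℝ) F G, B (r • F) G = r • B F G
  add_right : ∀ F G H, B F (G + H) = B F G + B F H
  smul_right : ∀ (r : ℝ) F G, B F (r • G) = r • B F G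
  parity : ∀ F G p q, C.HasParity F p → C.HasParity G q → C.HasParity (B F G) (p + q + 1)
  antisymm : ∀ F G p q, C.HasParity F p → C.HasParity G q →
    B F G = -(sgn ((p + 1) * (q + 1)) • B G F)
  jacobi : ∀ F G H p q r, C.HasParity F p → C.HasParity G q → C.HasParity H r →
    sgn ((p + 1) * (r + 1)) • B F (B G H) + sgn ((q + 1) * (p + 1)) • B G (B H F)
      + sgn ((r + 1) * (q + 1)) • B H (B F G) = 0

/-- The pair `B 0`, `B 1` is compatible. -/
def Compatible (B : Fin 2 → A → A → A) : Prop :=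
  ∀ α β : ℝ, C.IsAntibracket fun F G => α • B 0 F G + β • B 1 F G

/-- For a bilinear `K`, the bilinear operation given on homogeneous `F`, `G` of parities `p`, `q`
by `K(F, G) - (-1)^((p+1)(q+1)) K(G, F)`. -/
def antisymmetrize (K : A → A → A) (F G : A) : A :=
  K F G - ∑ p : ZMod 2, ∑ q : ZMod 2,
    sgn ((p + 1) * (q + 1)) • K (C.parityPart q G) (C.parityPart p F)

/-- The vector field `(-1)^{ε(c)} E^{cb} Φ_b ∂_c` made of a bracket and a covector field `Φ`. -/
def vectorField (B : A → A → A) (Φ : ι → A) (f : A) : A :=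
  ∑ c, ∑ b, sgn (par c) • (B (C.Γ c) (C.Γ b) * Φ b * C.D c f)

/-- The vector fields `V 0`, `V 1` differentiate the brackets `B 0`, `B 1` in the sense
symmetrized over the labels. -/
def DifferentiateSymm (V : Fin 2 → A → A) (B : Fin 2 → A → A → A) : Prop :=
  ∀ (a b : Fin 2) (F G : A) (p q : ZMod 2), C.HasParity F p → C.HasParity G q →
    V a (B b F G) + V b (B a F G) =
      (B b (V a F) G + B a (V b F) G) + sgn (p + 1) • (B b F (V a G) + B a F (V b G))

variable {C}

/-- On homogeneous arguments only one term of the double sum over parities survives. -/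
theorem antisymmetrize_apply (K : A → A → A) (hl : ∀ G, K 0 G = 0) (hr : ∀ F, K F 0 = 0)
    {F G : A} {p q : ZMod 2} (hF : C.HasParity F p) (hG : C.HasParity G q) :
    C.antisymmetrize K F G = K F G - sgn ((p + 1) * (q + 1)) • K G F := by
  rw [antisymmetrize, Finset.sum_eq_single p, Finset.sum_eq_single q, parityPart_self hF,
    parityPart_self hG]
  · intro q' _ h
    rw [parityPart_of_ne hG h, hl, smul_zero]
  · simp
  · intro p' _ h
    refine Finset.sum_eq_zero fun q' _ => ?_
    rw [parityPart_of_ne hF h, hr, smul_zero]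
  · simp

theorem IsAntibracket.zero_right {B : A → A → A} (hB : C.IsAntibracket B) (F : A) :
    B F 0 = 0 := by
  simpa using hB.smul_right 0 F 0

theorem IsAntibracket.neg_right {B : A → A → A} (hB : C.IsAntibracket B) (F G : A) :
    B F (-G) = -B F G := by
  simpa using hB.smul_right (-1) F G

/-- The bracket with an even function is a derivation of the bracket. -/
theorem IsAntibracket.jacobi_even {B : A → A → A} (hB : C.IsAntibracket B) {h F G : A}
    {p q : ZMod 2} (hh : C.HasParity h 0) (hF : C.HasParity F p) (hG : C.HasParity G q) :
    B h (B F G) = B (B h F) G + sgn (p + 1) • B F (B h G) := by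
  have h1 := hB.jacobi h F G 0 p q hh hF hG
  rw [hB.antisymm G h q 0 hG hh, hB.neg_right, hB.smul_right,
    hB.antisymm G (B h F) q (0 + p + 1) hG (hB.parity _ _ _ _ hh hF)] at h1
  rcases zmod2_cases p with rfl | rfl <;> rcases zmod2_cases q with rfl | rfl <;>
    simp only [zero_add, mul_one, mul_zero, zmod2_add_self 1, sgn_one,
      sgn_zero, one_smul, neg_smul, smul_neg, neg_neg, add_zero] at h1 ⊢ <;>
    first | linear_combination (norm := module) (1 : ℝ) • h1 | linear_combination (norm := module) (-1 : ℝ) • h1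

end Basic

/-! ### Brackets of weakly canonical form -/

section Weak

variable {n : ℕ} {εi εα : Fin n → ZMod 2} {A : Type} [Ring A] [Algebra ℝ A]
  {C : SuperCalculus (parity εi εα) A}

/-- The momentum coordinates. -/
abbrev Mom (n : ℕ) : Type := Fin n ⊕ Fin n

variable (C) in
/-- The operators `T_i = d^i_a ∂_{ξ_a}`. -/
def twist (d : Fin n → Mom n → A) (i : Fin n) : A →ₗ[ℝ] A :=
  ∑ a, LinearMap.mulLeft ℝ (d i a) ∘ₗ C.D (Sum.inr a)

variable (C) in
/-- Coefficients `d^i_a` that are homogeneous and do not depend on `x`. -/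
structure IsCoeff (d : Fin n → Mom n → A) : Prop where
  parity : ∀ i a, C.HasParity (d i a) (εi i + 1 + parity εi εα (Sum.inr a))
  indep : ∀ i a j, C.D (ix j) (d i a) = 0

variable (C) in
/-- The bracket with the coefficients `d`. -/
def bracket (d : Fin n → Mom n → A) : A → A → A :=
  C.antisymmetrize fun F G => ∑ i, C.Dr (ix i) F * C.twist d i G

theorem twist_apply (d : Fin n → Mom n → A) (i : Fin n) (f : A) :
    C.twist d i f = ∑ a, d i a * C.D (Sum.inr a) f := by
  simp [twist, LinearMap.sum_apply]

theorem parity_ix (i : Fin n) : parity εi εα (ix i) = εi i := rfl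

variable {d : Fin n → Mom n → A}

theorem HasParity.twist (hd : C.IsCoeff d) {f : A} {p : ZMod 2} (hf : C.HasParity f p)
    (i : Fin n) : C.HasParity (C.twist d i f) (p + (εi i + 1)) := by
  rw [twist_apply]
  refine HasParity.sum fun a _ => ((hd.parity i a).mul (hf.D _)).congr ?_
  generalize parity εi εα (Sum.inr a) = x
  generalize εi i = y
  generalize p = w
  revert x y w; decide

theorem twist_mul (hd : C.IsCoeff d) {f : A} {p : ZMod 2} (hf : C.HasParity f p)
    (i : Fin n) (g : A) :
    C.twist d i (f * g) = C.twist d i f * g + sgn ((εi i + 1) * p) • (f * C.twist d i g) := by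
  simp only [twist_apply, Finset.sum_mul, Finset.mul_sum, Finset.smul_sum,
    ← Finset.sum_add_distrib]
  refine Finset.sum_congr rfl fun a _ => ?_
  rw [D_mul _ hf, mul_add, mul_assoc, mul_smul_comm, ← mul_assoc (d i a) f,
    (hd.parity i a).mul_comm hf, smul_mul_assoc, smul_smul, sgn_mul_sgn, mul_assoc f]
  congr 3
  generalize parity εi εα (Sum.inr a) = x
  generalize εi i = y
  generalize p = w
  revert x y w; decide

/-- The coefficients do not depend on x, so only the partial derivatives have to be exchanged. -/
theorem twist_D (hd : C.IsCoeff d) (i j : Fin n) (f : A) :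
    C.twist d i (C.D (ix j) f) = sgn ((εi i + 1) * εi j) • C.D (ix j) (C.twist d i f) := by
  simp only [twist_apply, map_sum, Finset.smul_sum]
  refine Finset.sum_congr rfl fun a _ => ?_
  rw [D_mul _ (hd.parity i a), hd.indep, zero_mul, zero_add, C.D_comm, mul_smul_comm,
    smul_smul, sgn_mul_sgn, parity_ix]
  congr 2
  generalize parity εi εα (Sum.inr a) = x
  generalize εi i = y
  generalize εi j = z
  revert x y z; decide

theorem twist_x (i j : Fin n) : C.twist d i (C.Γ (ix j)) = 0 := by
  rw [twist_apply]
  exact Finset.sum_eq_zero fun a _ => by rw [C.D_Γ]; simp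

theorem twist_mom (i : Fin n) (a : Mom n) : C.twist d i (C.Γ (Sum.inr a)) = d i a := by
  rw [twist_apply, Finset.sum_eq_single a]
  · rw [C.D_Γ]; simp
  · intro b _ hb
    rw [C.D_Γ, if_neg (by simpa using hb), mul_zero]
  · simp

theorem D_x (i j : Fin n) : C.D (ix i) (C.Γ (ix j)) = if i = j then 1 else 0 := by
  rw [C.D_Γ]; simp

theorem D_mom (i : Fin n) (a : Mom n) : C.D (ix i) (C.Γ (Sum.inr a)) = 0 := by
  rw [C.D_Γ]; simp

theorem bracket_apply {F G : A} {p q : ZMod 2} (hF : C.HasParity F p) (hG : C.HasParity G q) :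
    C.bracket d F G =
      (∑ i, sgn (εi i * (p + 1)) • (C.D (ix i) F * C.twist d i G)) -
        sgn ((p + 1) * (q + 1)) •
          ∑ i, sgn (εi i * (q + 1)) • (C.D (ix i) G * C.twist d i F) := by
  rw [bracket, antisymmetrize_apply _ (by simp) (by simp) hF hG]
  simp only [Dr_eq _ hF, Dr_eq _ hG, smul_mul_assoc, parity_ix]

theorem bracket_x_left (hB : C.IsAntibracket (C.bracket d)) (i : Fin n) (G : A) :
    C.bracket d (C.Γ (ix i)) G = C.twist d i G := by
  refine homogeneous_induction (C := C) (fun q G hG => ?_)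
    (fun F G hF hG => ?_) G
  · have h0 : ∀ y : ZMod 2, y * (y + 1) = 0 := by decide
    rw [bracket_apply (hasParity_Γ (ix i)) hG]
    simp [twist_x, D_x, parity_ix, h0, sgn_zero]
  · rw [hB.add_right, map_add, hF, hG]

theorem bracket_x_right (hB : C.IsAntibracket (C.bracket d)) {F : A} {p : ZMod 2}
    (hF : C.HasParity F p) (i : Fin n) :
    C.bracket d F (C.Γ (ix i)) = -(sgn ((p + 1) * (εi i + 1)) • C.twist d i F) := by
  rw [hB.antisymm _ _ _ _ hF (hasParity_Γ (ix i)), bracket_x_left hB, parity_ix]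

theorem bracket_mom_mom (a b : Mom n) :
    C.bracket d (C.Γ (Sum.inr a)) (C.Γ (Sum.inr b)) = 0 := by
  rw [bracket_apply (hasParity_Γ _) (hasParity_Γ _)]
  simp [D_mom]

/-- This form of a Hamiltonian field is what `vectorField_bracket` is compared with: the two agree
when Φ is the gradient of h along x and along the operators T_i. -/
theorem bracket_even_left (hd : C.IsCoeff d) (hB : C.IsAntibracket (C.bracket d)) {h : A}
    (hh : C.HasParity h 0) (f : A) :
    C.bracket d h f = ∑ i, sgn (εi i) •
      (C.D (ix i) h * C.twist d i f + C.twist d i h * C.D (ix i) f) := by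
  refine homogeneous_induction (C := C) (fun q f hf => ?_)
    (fun f g hf hg => ?_) f
  · rw [bracket_apply hh hf, Finset.smul_sum, ← Finset.sum_sub_distrib]
    refine Finset.sum_congr rfl fun i _ => ?_
    rw [(hf.D (ix i)).mul_comm (hh.twist hd i), smul_add, smul_smul, smul_smul, sgn_mul_sgn,
      sgn_mul_sgn, parity_ix, sub_eq_add_neg, neg_sgn_smul]
    congr 3
    · simp
    · generalize εi i = y
      generalize q = w
      revert y w; decide
  · rw [hB.add_right, hf, hg, ← Finset.sum_add_distrib]
    refine Finset.sum_congr rfl fun i _ => ?_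
    simp only [map_add, mul_add, smul_add]
    abel

/-- By the Jacobi identity, the operators `T_i` supercommute. -/
theorem twist_comm_of_isAntibracket {B : A → A → A} (hB : C.IsAntibracket B)
    {T : Fin n → A →ₗ[ℝ] A} (hT : ∀ i G, B (C.Γ (ix i)) G = T i G)
    (hTx : ∀ i j, T i (C.Γ (ix j)) = 0) (i j : Fin n) (G : A) :
    T i (T j G) = sgn ((εi i + 1) * (εi j + 1)) • T j (T i G) := by
  refine homogeneous_induction (C := C) (fun r G hG => ?_)
    (fun F G hF hG => ?_) G
  -- In the Jacobi identity for x^i, x^j, G the term containing (x^i, x^j) drops out, which leaves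
  -- the supercommutator of T_i and T_j on G.
  · have h1 := hB.jacobi _ _ G _ _ r (hasParity_Γ (ix i)) (hasParity_Γ (ix j)) hG
    rw [hB.antisymm G _ r _ hG (hasParity_Γ (ix i)), hB.neg_right, hB.smul_right, hT, hT, hT,
      hT, hT, hTx, hB.zero_right, smul_zero, add_zero, parity_ix, parity_ix, smul_neg,
      smul_smul, sgn_mul_sgn, ← sub_eq_add_neg, sub_eq_zero] at h1
    have h2 := congrArg (sgn ((εi i + 1) * (r + 1)) • ·) h1
    simp only [smul_smul, sgn_mul_self, one_smul, sgn_mul_sgn] at h2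
    rw [h2]
    congr 2
    generalize εi i = y
    generalize εi j = z
    generalize r = w
    revert y z w; decide
  · simp only [map_add, smul_add, hF, hG]

theorem vectorField_bracket (hd : C.IsCoeff d) (hB : C.IsAntibracket (C.bracket d))
    {Φ : Idx n → A} (hΦ : ∀ a, C.HasParity (Φ a) (parity εi εα a)) (f : A) :
    C.vectorField (C.bracket d) Φ f = ∑ i, sgn (εi i) •
      (Φ (ix i) * C.twist d i f + (∑ a, d i a * Φ (Sum.inr a)) * C.D (ix i) f) := by
  have h1 : ∀ (i : Fin n) (a : Mom n), sgn (parity εi εα (Sum.inr a)) •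
      (C.bracket d (C.Γ (Sum.inr a)) (C.Γ (ix i)) * Φ (ix i) * C.D (Sum.inr a) f) =
      sgn (εi i) • (Φ (ix i) * (d i a * C.D (Sum.inr a) f)) := by
    intro i a
    rw [bracket_x_right hB (hasParity_Γ _), twist_mom, neg_sgn_smul, smul_mul_assoc,
      (hd.parity i a).mul_comm (hΦ (ix i)), smul_smul, sgn_mul_sgn, smul_mul_assoc, smul_smul,
      sgn_mul_sgn, mul_assoc, parity_ix]
    congr 2
    generalize parity εi εα (Sum.inr a) = x
    generalize εi i = y
    revert x y; decide
  rw [vectorField, Fintype.sum_sum_type]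
  simp only [Fintype.sum_sum_type (α₁ := Fin n) (α₂ := Mom n), bracket_x_left hB, twist_x,
    twist_mom, bracket_mom_mom, zero_mul, smul_zero, Finset.sum_const_zero, add_zero, zero_add]
  simp only [h1]
  rw [Finset.sum_comm (s := (Finset.univ : Finset (Mom n))), ← Finset.sum_add_distrib]
  refine Finset.sum_congr rfl fun i _ => ?_
  rw [twist_apply, smul_add, Finset.mul_sum, Finset.sum_mul, Finset.smul_sum, Finset.smul_sum,
    add_comm]
  rfl

end Weak

section Fields

variable {n : ℕ} {εi εα : Fin n → ZMod 2} {A : Type} [Ring A] [Algebra ℝ A]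
  {C : SuperCalculus (parity εi εα) A} {d : Fin n → Mom n → A}

/-! ### Vector fields differentiating a bracket -/

variable (C) in
/-- The vector field `(-1)^{ε(i)} (φ_i T_i + ψ_i ∂_{x^i})`. -/
def hamField (d : Fin n → Mom n → A) (φ ψ : Fin n → A) (f : A) : A :=
  ∑ i, sgn (εi i) • (φ i * C.twist d i f + ψ i * C.D (ix i) f)

theorem hamField_x (φ ψ : Fin n → A) (i : Fin n) :
    C.hamField d φ ψ (C.Γ (ix i)) = sgn (εi i) • ψ i := by
  rw [hamField, Finset.sum_eq_single i]
  · simp [twist_x, D_x]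
  · intro j _ hj
    simp [twist_x, D_x, hj]
  · simp

theorem hamField_of_indep (φ ψ : Fin n → A) {f : A} (hf : ∀ i, C.D (ix i) f = 0) :
    C.hamField d φ ψ f = ∑ i, sgn (εi i) • (φ i * C.twist d i f) := by
  simp [hamField, hf]

theorem hamField_zero (φ ψ : Fin n → A) : C.hamField d φ ψ 0 = 0 := by
  simp [hamField]

/-- The components χ need not come from the bracket with coefficients d, so the formula serves both
the test of one bracket and the mixed test of two. -/
theorem bracket_x_x (hB : C.IsAntibracket (C.bracket d)) {χ : Fin n → A}
    (hχ : ∀ i, C.HasParity (χ i) (εi i + 1)) (i j : Fin n) :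
    C.bracket d (sgn (εi i) • χ i) (C.Γ (ix j)) +
      sgn (εi i + 1) • C.bracket d (C.Γ (ix i)) (sgn (εi j) • χ j) =
    sgn (εi i + 1 + εi j) • (C.twist d i (χ j) -
      sgn ((εi i + 1) * (εi j + 1)) • C.twist d j (χ i)) := by
  rw [hB.smul_left, hB.smul_right, bracket_x_left hB, bracket_x_right hB (hχ i), smul_neg,
    smul_smul, smul_smul, sgn_mul_sgn, sgn_mul_sgn, smul_sub, smul_smul, sgn_mul_sgn, add_comm,
    sub_eq_add_neg]
  congr 4
  generalize εi i = y
  generalize εi j = z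
  revert y z; decide

section Differentiates

variable (hd : C.IsCoeff d) (hB : C.IsAntibracket (C.bracket d)) {φ ψ : Fin n → A}
  (hφ : ∀ i, C.HasParity (φ i) (εi i)) (hψ : ∀ i, C.HasParity (ψ i) (εi i + 1))
  (hV : ∀ F G p q, C.HasParity F p → C.HasParity G q →
    C.hamField d φ ψ (C.bracket d F G) = C.bracket d (C.hamField d φ ψ F) G +
      sgn (p + 1) • C.bracket d F (C.hamField d φ ψ G))

include hB hψ hV in
-- Test on the pair (x^i, x^j), whose bracket is zero.
theorem twist_eq_of_differentiates (i j : Fin n) :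
    C.twist d i (ψ j) = sgn ((εi i + 1) * (εi j + 1)) • C.twist d j (ψ i) := by
  have h1 := hV _ _ _ _ (hasParity_Γ (ix i)) (hasParity_Γ (ix j))
  rw [bracket_x_left hB, twist_x, hamField_x, hamField_x, hamField_zero, parity_ix,
    bracket_x_x hB hψ, eq_comm, smul_eq_zero] at h1
  exact sub_eq_zero.1 (h1.resolve_left (sgn_ne_zero _))

include hd hB hφ hψ hV in
-- Test on the pair (x^i, ξ_a), whose bracket is d^i_a. The matrix d stays as a right factor, to be
-- cancelled when it is nondegenerate.
theorem sum_mul_coeff_of_differentiates (i : Fin n) (a : Mom n) :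
    ∑ j, (sgn (εi j) • (C.twist d i (φ j) -
      sgn ((εi i + 1) * εi j) • C.D (ix j) (ψ i))) * d j a = 0 := by
  have h1 := hV _ _ _ _ (hasParity_Γ (ix i)) (hasParity_Γ (Sum.inr a))
  rw [bracket_x_left hB, bracket_x_left hB, twist_mom, hamField_x, hB.smul_left,
    bracket_apply (hψ i) (hasParity_Γ (Sum.inr a)), hamField_of_indep _ _ (hd.indep i a),
    hamField_of_indep _ _ fun i => D_mom i a] at h1
  simp only [twist_mom, D_mom, zero_mul, smul_zero, Finset.sum_const_zero, sub_zero, map_sum,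
    map_smul, twist_mul hd (hφ _), Finset.smul_sum, parity_ix] at h1
  rw [← Finset.sum_add_distrib, ← sub_eq_zero, ← Finset.sum_sub_distrib] at h1
  have h2 := congrArg (sgn (εi i) • ·) h1
  simp only [smul_zero, Finset.smul_sum] at h2
  rw [← h2]
  refine Finset.sum_congr rfl fun j _ => ?_
  -- Supercommutation of the T_i, applied to ξ_a; it makes the terms with derivatives of d cancel.
  have h3 : C.twist d j (d i a) = sgn ((εi j + 1) * (εi i + 1)) • C.twist d i (d j a) := by
    rw [← twist_mom (C := C) (d := d) i a, ← twist_mom (C := C) (d := d) j a]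
    exact twist_comm_of_isAntibracket hB (bracket_x_left hB) twist_x j i _
  rw [h3]
  simp only [sub_mul, smul_sub, smul_add, smul_mul_assoc, mul_smul_comm, smul_smul,
    sgn_mul_sgn]
  rcases zmod2_cases (εi i) with h | h <;> rcases zmod2_cases (εi j) with h' | h' <;>
    simp only [h, h', zero_add, mul_one, mul_zero, add_zero, zmod2_add_self 1, sgn_one,
      sgn_zero, one_smul, neg_smul] <;> abel

end Differentiates

/-! ### Shifts of `x` depending on the momenta -/

variable (C) in
/-- The vector field `(-1)^{ε(i)} η_i ∂_{x^i}`. -/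
def shift (η : Fin n → A) : A →ₗ[ℝ] A :=
  ∑ j, sgn (εi j) • (LinearMap.mulLeft ℝ (η j) ∘ₗ C.D (ix j))

theorem shift_apply (η : Fin n → A) (f : A) :
    C.shift η f = ∑ j, sgn (εi j) • (η j * C.D (ix j) f) := by
  simp [shift, LinearMap.sum_apply]

section Shift

variable {η : Fin n → A} (hη : ∀ i, C.HasParity (η i) (εi i + 1))
  (hηx : ∀ i j, C.D (ix j) (η i) = 0)

include hη in
theorem HasParity.shift {f : A} {p : ZMod 2} (hf : C.HasParity f p) :
    C.HasParity (C.shift η f) (p + 1) := by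
  rw [shift_apply]
  refine HasParity.sum fun i _ => HasParity.smul (((hη i).mul (hf.D (ix i))).congr ?_) _
  rw [parity_ix]
  generalize εi i = y
  generalize p = w
  revert y w; decide

include hη in
theorem shift_mul {f : A} {p : ZMod 2} (hf : C.HasParity f p) (g : A) :
    C.shift η (f * g) = C.shift η f * g + sgn p • (f * C.shift η g) := by
  simp only [shift_apply, Finset.sum_mul, Finset.mul_sum, Finset.smul_sum,
    ← Finset.sum_add_distrib]
  refine Finset.sum_congr rfl fun i _ => ?_
  rw [D_mul _ hf, mul_add, smul_add, mul_smul_comm, ← mul_assoc (η i) f, (hη i).mul_comm hf,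
    mul_smul_comm]
  simp only [smul_mul_assoc, smul_smul, sgn_mul_sgn, mul_assoc, parity_ix]
  congr 3
  generalize εi i = y
  generalize p = w
  revert y w; decide

include hη hηx in
theorem shift_D (i : Fin n) (f : A) :
    C.shift η (C.D (ix i) f) = sgn (εi i) • C.D (ix i) (C.shift η f) := by
  simp only [shift_apply, map_sum, Finset.smul_sum, map_smul]
  refine Finset.sum_congr rfl fun j _ => ?_
  rw [D_mul _ (hη j), hηx, zero_mul, zero_add, C.D_comm, mul_smul_comm]
  simp only [smul_smul, sgn_mul_sgn, parity_ix]
  congr 2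
  generalize εi i = y
  generalize εi j = z
  revert y z; decide

include hη in
-- The supercommutator of T_i with the shift is again a field along x, with components T_i η_j.
theorem shift_twist (hd : C.IsCoeff d) (i : Fin n) (f : A) :
    C.shift η (C.twist d i f) = sgn (εi i + 1) • (C.twist d i (C.shift η f) -
      ∑ j, sgn (εi j) • (C.twist d i (η j) * C.D (ix j) f)) := by
  simp only [shift_apply, map_sum, ← Finset.sum_sub_distrib, Finset.smul_sum, map_smul]
  refine Finset.sum_congr rfl fun j _ => ?_
  rw [twist_mul hd (hη j), twist_D hd, smul_add, add_sub_cancel_left, mul_smul_comm]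
  simp only [smul_smul, sgn_mul_sgn]
  congr 2
  generalize εi i = y
  generalize εi j = z
  revert y z; decide

variable (C) in
/-- The unsymmetrized bracket, for `F` of parity `p`. -/
def halfBracket (d : Fin n → Mom n → A) (p : ZMod 2) (F G : A) : A :=
  ∑ i, sgn (εi i * (p + 1)) • (C.D (ix i) F * C.twist d i G)

variable (C) in
/-- The failure of a shift to differentiate the unsymmetrized bracket. -/
def shiftDefect (d : Fin n → Mom n → A) (η : Fin n → A) (p : ZMod 2) (F G : A) : A :=
  ∑ i, ∑ j, sgn (εi i * (p + 1) + εi j) •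
    (C.D (ix i) F * (C.twist d i (η j) * C.D (ix j) G))

include hη hηx in
-- The shift is an odd derivation and supercommutes with ∂_x because η does not depend on x. Only
-- its commutator with T_i obstructs, and that produces the defect.
theorem shift_halfBracket (hd : C.IsCoeff d) {F : A} {p : ZMod 2} (hF : C.HasParity F p)
    (G : A) :
    C.shift η (C.halfBracket d p F G) = C.halfBracket d (p + 1) (C.shift η F) G +
      sgn (p + 1) • C.halfBracket d p F (C.shift η G) -
        sgn (p + 1) • C.shiftDefect d η p F G := by
  simp only [halfBracket, shiftDefect, map_sum, Finset.smul_sum, ← Finset.sum_add_distrib,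
    ← Finset.sum_sub_distrib]
  refine Finset.sum_congr rfl fun i _ => ?_
  rw [map_smul, shift_mul hη (hF.D (ix i)), shift_D hη hηx, shift_twist hη hd]
  simp only [smul_add, smul_sub, mul_sub, Finset.mul_sum, Finset.smul_sum, smul_mul_assoc,
    mul_smul_comm, smul_smul, sgn_mul_sgn, parity_ix, add_sub_assoc]
  congr 1
  · congr 2
    generalize εi i = y
    generalize p = w
    revert y w; decide
  · have h1 : ∀ y w : ZMod 2, y * (w + 1) + w + y + y + 1 = w + 1 + y * (w + 1) := by
      decide
    simp only [← add_assoc, sub_eq_add_neg, h1]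

include hη in
-- Supersymmetry of T_i η_j makes the defect symmetric under the exchange of F and G, with the sign
-- for which it cancels in the antisymmetrized bracket.
theorem shiftDefect_comm (hd : C.IsCoeff d)
    (hs : ∀ i j, C.twist d i (η j) = sgn ((εi i + 1) * (εi j + 1)) • C.twist d j (η i))
    {F G : A} {p q : ZMod 2} (hF : C.HasParity F p) (hG : C.HasParity G q) :
    sgn (p + 1) • C.shiftDefect d η p F G =
      sgn (p * (q + 1)) • C.shiftDefect d η q G F := by
  rw [shiftDefect, shiftDefect, Finset.sum_comm, Finset.smul_sum, Finset.smul_sum]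
  refine Finset.sum_congr rfl fun j _ => ?_
  rw [Finset.smul_sum, Finset.smul_sum]
  refine Finset.sum_congr rfl fun i _ => ?_
  rw [hs i j, smul_mul_assoc, mul_smul_comm,
    (hF.D (ix i)).mul_comm (((hη i).twist hd j).mul (hG.D (ix j))),
    ((hη i).twist hd j).mul_comm (hG.D (ix j))]
  simp only [smul_mul_assoc, smul_smul, sgn_mul_sgn, mul_assoc, parity_ix]
  congr 2
  generalize εi i = y
  generalize εi j = z
  generalize p = w
  generalize q = v
  revert y z w v; decide

include hη hηx in
/-- A shift whose components satisfy the integrability condition differentiates the bracket. -/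
theorem shift_bracket (hd : C.IsCoeff d)
    (hs : ∀ i j, C.twist d i (η j) = sgn ((εi i + 1) * (εi j + 1)) • C.twist d j (η i))
    {F G : A} {p q : ZMod 2} (hF : C.HasParity F p) (hG : C.HasParity G q) :
    C.shift η (C.bracket d F G) =
      C.bracket d (C.shift η F) G + sgn (p + 1) • C.bracket d F (C.shift η G) := by
  have hb : ∀ {F G : A} {p q : ZMod 2}, C.HasParity F p → C.HasParity G q →
      C.bracket d F G = C.halfBracket d p F G -
        sgn ((p + 1) * (q + 1)) • C.halfBracket d q G F := fun hF hG => bracket_apply hF hG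
  rw [hb hF hG, hb (hF.shift hη) hG, hb hF (hG.shift hη), map_sub, map_smul,
    shift_halfBracket hη hηx hd hF, shift_halfBracket hη hηx hd hG,
    shiftDefect_comm hη hd hs hF hG]
  rcases zmod2_cases p with rfl | rfl <;> rcases zmod2_cases q with rfl | rfl <;>
    simp only [zero_add, mul_one, mul_zero, zmod2_add_self 1, sgn_one, sgn_zero, one_smul,
      neg_smul] <;> abel

end Shift

end Fields

/-! ### Polarized Jacobi identity of a compatible pair -/

section Compatible

variable {ι : Type} [Fintype ι] [DecidableEq ι] {par : ι → ZMod 2} {A : Type}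
    [Ring A] [Algebra ℝ A] {C : SuperCalculus par A} {B : Fin 2 → A → A → A}

theorem Compatible.isAntibracket (hB : C.Compatible B) (k : Fin 2) : C.IsAntibracket (B k) := by
  fin_cases k
  · simpa using hB 1 0
  · simpa using hB 0 1

theorem Compatible.isAntibracket_add (hB : C.Compatible B) :
    C.IsAntibracket fun F G => B 0 F G + B 1 F G := by
  simpa using hB 1 1

/-- Polarization: subtract the identities of the two brackets from the identity of their sum. -/
theorem Compatible.jacobi_even (hB : C.Compatible B) {h F G : A} {p q : ZMod 2}
    (hh : C.HasParity h 0) (hF : C.HasParity F p) (hG : C.HasParity G q) :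
    B 0 h (B 1 F G) + B 1 h (B 0 F G) = (B 1 (B 0 h F) G + B 0 (B 1 h F) G) +
      sgn (p + 1) • (B 1 F (B 0 h G) + B 0 F (B 1 h G)) := by
  have h0 := (hB.isAntibracket 0).jacobi_even hh hF hG
  have h1 := (hB.isAntibracket 1).jacobi_even hh hF hG
  have h2 := hB.isAntibracket_add.jacobi_even hh hF hG
  simp only [(hB.isAntibracket 0).add_left, (hB.isAntibracket 1).add_left,
    (hB.isAntibracket 0).add_right, (hB.isAntibracket 1).add_right] at h2
  linear_combination (norm := module) (1 : ℝ) • h2 - (1 : ℝ) • h1 - (1 : ℝ) • h0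

end Compatible

/-! ### Coefficient matrices and their cancellation -/

section Coefficients

variable {n : ℕ} {A : Type} [Ring A]

/-- The coefficients of the two weakly canonical brackets. -/
def coeff (e : Matrix (Fin n) (Fin n) A) : Fin 2 → Fin n → Mom n → A :=
  ![fun i => Sum.elim (fun j => if i = j then 1 else 0) 0, fun i => Sum.elim 0 (e i)]

variable {e : Matrix (Fin n) (Fin n) A}

theorem sum_coeff_zero_mul (i : Fin n) (x : Mom n → A) :
    ∑ a, coeff e 0 i a * x a = x (Sum.inl i) := by
  simp [coeff]

theorem sum_coeff_one_mul (i : Fin n) (x : Mom n → A) :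
    ∑ a, coeff e 1 i a * x a = ∑ α, e i α * x (Sum.inr α) := by
  simp [coeff]

/-- The entries lie in a noncommutative ring, so cancelling e from the left and, in the next lemma,
from the right are separate statements. -/
theorem eq_zero_of_sum_mul (he : IsUnit e) {x : Fin n → A}
    (h : ∀ i, ∑ α, e i α * x α = 0) (α : Fin n) : x α = 0 := by
  obtain ⟨u, rfl⟩ := he
  have h1 : (u : Matrix (Fin n) (Fin n) A).mulVec x = 0 := funext h
  have h2 := congrArg ((u⁻¹ : (Matrix (Fin n) (Fin n) A)ˣ) : Matrix (Fin n) (Fin n) A).mulVec h1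
  rw [Matrix.mulVec_mulVec, Units.inv_mul, Matrix.one_mulVec, Matrix.mulVec_zero] at h2
  exact congrFun h2 α

theorem eq_zero_of_sum_mul' (he : IsUnit e) {x : Fin n → A}
    (h : ∀ α, ∑ i, x i * e i α = 0) (i : Fin n) : x i = 0 := by
  obtain ⟨u, rfl⟩ := he
  have h1 : Matrix.vecMul x (u : Matrix (Fin n) (Fin n) A) = 0 := funext h
  have h2 := congrArg (fun v => Matrix.vecMul v
    ((u⁻¹ : (Matrix (Fin n) (Fin n) A)ˣ) : Matrix (Fin n) (Fin n) A)) h1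
  simp only [Matrix.vecMul_vecMul, Units.mul_inv, Matrix.vecMul_one, Matrix.zero_vecMul] at h2
  exact congrFun h2 i

theorem eq_zero_of_sum_mul_coeff (he : IsUnit e) (k : Fin 2) {x : Fin n → A}
    (h : ∀ a, ∑ j, x j * coeff e k j a = 0) (j : Fin n) : x j = 0 := by
  fin_cases k
  · simpa [coeff] using h (Sum.inl j)
  · exact eq_zero_of_sum_mul' he (fun α => h (Sum.inr α)) j

/-- The components `d^i_a Φ_{ξ_a}` of the vector field of a covector field. -/
def momComp (e : Matrix (Fin n) (Fin n) A) (Φ : Idx n → A) (k : Fin 2) (i : Fin n) : A :=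
  ∑ a, coeff e k i a * Φ (Sum.inr a)

theorem momComp_zero (i : Fin n) : momComp e Φ 0 i = Φ (i1 i) :=
  sum_coeff_zero_mul i fun a => Φ (Sum.inr a)

theorem momComp_one (i : Fin n) : momComp e Φ 1 i = ∑ α, e i α * Φ (i2 α) :=
  sum_coeff_one_mul i fun a => Φ (Sum.inr a)

end Coefficients

/-! ### The two weakly canonical brackets and the equation for H -/

section Weak

variable {n : ℕ} {εi εα : Fin n → ZMod 2} {A : Type} [Ring A] [Algebra ℝ A]
  (C : SuperCalculus (parity εi εα) A)

/-- `f` does not depend on the coordinates `x`. -/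
def IndepX (f : A) : Prop := ∀ i : Fin n, C.D (ix i) f = 0

/-- `e` is an admissible matrix for weakly canonical brackets. -/
structure IsEStructure (e : Matrix (Fin n) (Fin n) A) : Prop where
  parity : ∀ i α, C.HasParity (e i α) (εi i + εα α)
  indep : ∀ i α, C.IndepX (e i α)
  nondeg : IsUnit e

/-- The pair of brackets of weakly canonical form. -/
def weakBracket (e : Matrix (Fin n) (Fin n) A) : Fin 2 → A → A → A :=
  ![C.antisymmetrize fun F G => ∑ i, C.Dr (ix i) F * C.D (i1 i) G,
    C.antisymmetrize fun F G => ∑ i, ∑ α, C.Dr (ix i) F * e i α * C.D (i2 α) G]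

/-- The equation for `H`. -/
def SolvesHEquation (e : Matrix (Fin n) (Fin n) A) (H : A) : Prop :=
  ∀ i j : Fin n,
    ∑ α, e i α * C.D (i2 α) (C.D (i1 j) H)
      - sgn ((εi i + 1) * (εi j + 1)) • ∑ α, e j α * C.D (i2 α) (C.D (i1 i) H) = 0

variable {C} {e : Matrix (Fin n) (Fin n) A}

theorem twist_coeff_zero (i : Fin n) (f : A) : C.twist (coeff e 0) i f = C.D (i1 i) f := by
  rw [twist_apply, sum_coeff_zero_mul i fun a => C.D (Sum.inr a) f]

theorem twist_coeff_one (i : Fin n) (f : A) :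
    C.twist (coeff e 1) i f = ∑ α, e i α * C.D (i2 α) f := by
  rw [twist_apply, sum_coeff_one_mul i fun a => C.D (Sum.inr a) f]

theorem weakBracket_eq (e : Matrix (Fin n) (Fin n) A) (k : Fin 2) :
    C.weakBracket e k = C.bracket (coeff e k) := by
  fin_cases k
  · simp only [bracket, twist_coeff_zero, weakBracket, Fin.zero_eta, Matrix.cons_val_zero]
  · simp only [bracket, twist_coeff_one, weakBracket, Fin.mk_one, Matrix.cons_val_one,
      Matrix.cons_val_fin_one, Finset.mul_sum, mul_assoc]

theorem isCoeff_coeff (he : C.IsEStructure e) (k : Fin 2) : C.IsCoeff (coeff e k) := by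
  fin_cases k
  · refine ⟨fun i a => ?_, fun i a j => ?_⟩
    · rcases a with j | α
      · by_cases h : i = j
        · subst h
          simpa [coeff, parity, zmod2_add_self] using HasParity.one (C := C)
        · simpa [coeff, h] using HasParity.zero (C := C) _
      · simpa [coeff] using HasParity.zero (C := C) _
    · rcases a with m | α
      · by_cases h : i = m
        · simp [coeff, h, C.D_one]
        · simp [coeff, h]
      · simp [coeff]
  · refine ⟨fun i a => ?_, fun i a j => ?_⟩
    · rcases a with j | α
      · simpa [coeff] using HasParity.zero (C := C) _
      · refine (he.parity i α).congr ?_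
        simp only [parity, Sum.elim_inr]
        generalize εi i = y
        generalize εα α = z
        revert y z; decide
    · rcases a with m | α
      · simp [coeff]
      · exact he.indep i α j

variable (he : C.IsEStructure e) (hcomp : C.Compatible (C.weakBracket e))

include hcomp in
theorem isAntibracket_bracket (k : Fin 2) : C.IsAntibracket (C.bracket (coeff e k)) := by
  rw [← weakBracket_eq]; exact hcomp.isAntibracket k

include hcomp in
theorem twist_coeff_comm (k : Fin 2) (i j : Fin n) (f : A) :
    C.twist (coeff e k) i (C.twist (coeff e k) j f) =
      sgn ((εi i + 1) * (εi j + 1)) • C.twist (coeff e k) j (C.twist (coeff e k) i f) :=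
  twist_comm_of_isAntibracket (isAntibracket_bracket hcomp k)
    (bracket_x_left (isAntibracket_bracket hcomp k)) twist_x i j f

include hcomp in
-- The operators T^1_i + T^2_i belong to the sum of the brackets and hence supercommute; the unmixed
-- relations are subtracted.
theorem twist_coeff_comm_mixed (i j : Fin n) (f : A) :
    C.twist (coeff e 0) i (C.twist (coeff e 1) j f) +
        C.twist (coeff e 1) i (C.twist (coeff e 0) j f) =
      sgn ((εi i + 1) * (εi j + 1)) • (C.twist (coeff e 0) j (C.twist (coeff e 1) i f) +
        C.twist (coeff e 1) j (C.twist (coeff e 0) i f)) := by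
  have h := twist_comm_of_isAntibracket hcomp.isAntibracket_add
    (T := fun i => C.twist (coeff e 0) i + C.twist (coeff e 1) i) (fun i G => by
      rw [weakBracket_eq, weakBracket_eq, bracket_x_left (isAntibracket_bracket hcomp 0),
        bracket_x_left (isAntibracket_bracket hcomp 1)]
      rfl) (fun i j => by simp [twist_x]) i j f
  simp only [LinearMap.add_apply, map_add] at h
  linear_combination (norm := module) (1 : ℝ) • h -
    (1 : ℝ) • twist_coeff_comm hcomp 0 i j f - (1 : ℝ) • twist_coeff_comm hcomp 1 i j f

include he hcomp in
-- Everything except the opposite signs of H is the Jacobi identity. In the mixed case, -½(H, ·)^1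
-- and ½(H, ·)^2 differ from the harmless pair with equal signs ½ by (H, ·)^1 acting on the second
-- bracket.
theorem differentiateSymm_of_exists {V : Fin 2 → A → A} {H h : A} (hH : C.HasParity H 0)
    (hh : C.HasParity h 0) (hHx : C.IndepX H) (hHe : C.SolvesHEquation e H)
    (hV0 : ∀ f, V 0 f = C.weakBracket e 0 (-(1 / 2 : ℝ) • H) f + C.weakBracket e 0 h f)
    (hV1 : ∀ f, V 1 f = C.weakBracket e 1 ((1 / 2 : ℝ) • H) f + C.weakBracket e 1 h f) :
    C.DifferentiateSymm V (C.weakBracket e) := by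
  have B0 := hcomp.isAntibracket 0
  have B1 := hcomp.isAntibracket 1
  have hd := isCoeff_coeff he
  -- As H does not depend on x, only the ∂_x half of its Hamiltonian field remains.
  have hshift : ∀ f, C.weakBracket e 0 H f =
      C.shift (fun i => C.twist (coeff e 0) i H) f := by
    intro f
    rw [weakBracket_eq, bracket_even_left (hd 0) (isAntibracket_bracket hcomp 0) hH,
      shift_apply]
    simp [hHx _]
  -- The equation for H enters here, as the integrability condition of this shift with respect to
  -- the second bracket.
  have hJ : ∀ F G p q, C.HasParity F p → C.HasParity G q →
      C.weakBracket e 0 H (C.weakBracket e 1 F G) =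
        C.weakBracket e 1 (C.weakBracket e 0 H F) G +
          sgn (p + 1) • C.weakBracket e 1 F (C.weakBracket e 0 H G) := by
    intro F G p q hF hG
    simp only [hshift]
    rw [weakBracket_eq e 1]
    refine shift_bracket (fun i => (hH.twist (hd 0) i).congr (zero_add _)) (fun i j => ?_)
      (hd 1) (fun i j => ?_) hF hG
    · have := twist_D (hd 0) i j H
      rw [hHx, map_zero, eq_comm, smul_eq_zero] at this
      exact this.resolve_left (sgn_ne_zero _)
    · simpa only [twist_coeff_zero, twist_coeff_one] using sub_eq_zero.1 (hHe i j)
  have hsymm : ∀ F G p q, C.HasParity F p → C.HasParity G q →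
      V 0 (C.weakBracket e 1 F G) + V 1 (C.weakBracket e 0 F G) =
        (C.weakBracket e 1 (V 0 F) G + C.weakBracket e 0 (V 1 F) G) +
          sgn (p + 1) • (C.weakBracket e 1 F (V 0 G) + C.weakBracket e 0 F (V 1 G)) := by
    intro F G p q hF hG
    have h1 := hJ F G p q hF hG
    have h2 := hcomp.jacobi_even hH hF hG
    have h3 := hcomp.jacobi_even hh hF hG
    simp only [hV0, hV1, B0.smul_left, B1.smul_left, B0.add_left, B1.add_left, B0.add_right,
      B1.add_right, B0.smul_right, B1.smul_right]
    linear_combination (norm := module) (1 : ℝ) • h3 + (1 / 2 : ℝ) • h2 - (1 : ℝ) • h1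
  have hsame : ∀ k : Fin 2, ∀ (c : ℝ),
      (∀ f, V k f = C.weakBracket e k (c • H) f + C.weakBracket e k h f) →
      ∀ F G p q, C.HasParity F p → C.HasParity G q →
      V k (C.weakBracket e k F G) = C.weakBracket e k (V k F) G +
        sgn (p + 1) • C.weakBracket e k F (V k G) := by
    intro k c hk F G p q hF hG
    simp only [hk, ← (hcomp.isAntibracket k).add_left]
    exact (hcomp.isAntibracket k).jacobi_even ((hH.smul c).add hh) hF hG
  intro a b F G p q hF hG
  fin_cases a <;> fin_cases b
  · have := hsame 0 _ hV0 F G p q hF hG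
    simp only [Fin.zero_eta]
    rw [this, smul_add]; abel
  · exact hsymm F G p q hF hG
  · have := hsymm F G p q hF hG
    simp only [Fin.zero_eta, Fin.mk_one]
    rw [add_comm, this]
    abel_nf
  · have := hsame 1 _ hV1 F G p q hF hG
    simp only [Fin.mk_one]
    rw [this, smul_add]; abel

/-! ### Closedness of the one-form and existence of the potentials -/

section Potentials

variable {Φ : Idx n → A} (hΦ : ∀ a, C.HasParity (Φ a) (parity εi εα a))

include he hΦ in
theorem hasParity_momComp (k : Fin 2) (i : Fin n) :
    C.HasParity (momComp e Φ k i) (εi i + 1) := by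
  refine HasParity.sum fun a _ => (((isCoeff_coeff he k).parity i a).mul (hΦ (Sum.inr a))).congr ?_
  rw [add_assoc, zmod2_add_self, add_zero]

include he hcomp hΦ in
theorem vectorField_weakBracket (k : Fin 2) :
    C.vectorField (C.weakBracket e k) Φ =
      C.hamField (coeff e k) (fun i => Φ (ix i)) (momComp e Φ k) := by
  funext f
  rw [weakBracket_eq, vectorField_bracket (isCoeff_coeff he k) (isAntibracket_bracket hcomp k) hΦ]
  rfl

variable (hsymm : C.DifferentiateSymm (fun a => C.vectorField (C.weakBracket e a) Φ)
  (C.weakBracket e))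

include he hcomp hΦ hsymm in
theorem differentiates_of_symm (k : Fin 2) (F G : A) (p q : ZMod 2) (hF : C.HasParity F p)
    (hG : C.HasParity G q) :
    C.hamField (coeff e k) (fun i => Φ (ix i)) (momComp e Φ k) (C.bracket (coeff e k) F G) =
      C.bracket (coeff e k)
        (C.hamField (coeff e k) (fun i => Φ (ix i)) (momComp e Φ k) F) G +
      sgn (p + 1) • C.bracket (coeff e k) F
        (C.hamField (coeff e k) (fun i => Φ (ix i)) (momComp e Φ k) G) := by
  have h := hsymm k k F G p q hF hG
  simp only [vectorField_weakBracket he hcomp hΦ] at h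
  simp only [weakBracket_eq] at h
  linear_combination (norm := module) (1 / 2 : ℝ) • h

include he hcomp hΦ hsymm in
theorem twist_momComp_of_symm (k : Fin 2) (i j : Fin n) :
    C.twist (coeff e k) i (momComp e Φ k j) =
      sgn ((εi i + 1) * (εi j + 1)) • C.twist (coeff e k) j (momComp e Φ k i) :=
  twist_eq_of_differentiates (isAntibracket_bracket hcomp k) (hasParity_momComp he hΦ k)
    (differentiates_of_symm he hcomp hΦ hsymm k) i j

include he hcomp hΦ hsymm in
theorem twist_x_of_symm (k : Fin 2) (i j : Fin n) :
    C.twist (coeff e k) i (Φ (ix j)) =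
      sgn ((εi i + 1) * εi j) • C.D (ix j) (momComp e Φ k i) := by
  have h := eq_zero_of_sum_mul_coeff he.nondeg k (sum_mul_coeff_of_differentiates (isCoeff_coeff he k)
    (isAntibracket_bracket hcomp k) (fun i => hΦ (ix i)) (hasParity_momComp he hΦ k)
    (differentiates_of_symm he hcomp hΦ hsymm k) i) j
  rw [smul_eq_zero] at h
  exact sub_eq_zero.1 (h.resolve_left (sgn_ne_zero _))

include he hcomp hΦ hsymm in
-- Test the first bracket on (ξ_{1i}, ξ_{1j}): the bracket is zero, and V^1 sends ξ_{1i} to F_{x^i}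
-- up to sign. This part of closedness serves both potentials.
theorem D_x_of_symm (i j : Fin n) :
    C.D (ix i) (Φ (ix j)) = sgn (εi i * εi j) • C.D (ix j) (Φ (ix i)) := by
  have hham : ∀ i, C.hamField (coeff e 0) (fun i => Φ (ix i)) (momComp e Φ 0)
      (C.Γ (i1 i)) = sgn (εi i) • Φ (ix i) := by
    intro i
    rw [hamField_of_indep _ _ fun j => D_mom j _, Finset.sum_eq_single i]
    · simp [twist_mom, coeff]
    · intro j _ hj
      simp [twist_mom, coeff, hj]
    · simp
  have h1 := differentiates_of_symm he hcomp hΦ hsymm 0 _ _ _ _ (hasParity_Γ (i1 i))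
    (hasParity_Γ (i1 j))
  have hB := isAntibracket_bracket hcomp 0
  rw [hham, hham, bracket_mom_mom, hamField_zero, hB.smul_left, hB.smul_right,
    bracket_apply (hΦ (ix i)) (hasParity_Γ (i1 j)),
    bracket_apply (hasParity_Γ (i1 i)) (hΦ (ix j))] at h1
  have hi : ∀ i, parity εi εα (i1 i) = εi i + 1 := fun _ => rfl
  have hD : ∀ i j, C.D (i1 i) (C.Γ (i1 j)) = if i = j then 1 else 0 := by
    intro i j
    rw [C.D_Γ]; simp
  simp only [twist_coeff_zero, D_mom, zero_mul, smul_zero, Finset.sum_const_zero,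
    sub_zero, zero_sub] at h1
  simp only [hD, hi, mul_ite, mul_one, mul_zero, smul_ite, smul_zero,
    Finset.sum_ite_eq', Finset.mem_univ, if_true] at h1
  rcases zmod2_cases (εi i) with h | h <;> rcases zmod2_cases (εi j) with h' | h' <;>
    simp only [h, h', parity_ix, zero_add, mul_one, mul_zero, zmod2_add_self 1, sgn_one,
      sgn_zero, one_smul, neg_smul, smul_neg, neg_neg] at h1 ⊢ <;>
    first
    | linear_combination (norm := module) (1 : ℝ) • h1
    | linear_combination (norm := module) (-1 : ℝ) • h1

include he hcomp hΦ hsymm in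
/-- The one-form `Φ` is closed along `x`, `ξ_2`. -/
theorem D_i2_x_of_symm (α j : Fin n) :
    C.D (i2 α) (Φ (ix j)) = sgn ((εα α + 1) * εi j) • C.D (ix j) (Φ (i2 α)) := by
  refine sub_eq_zero.1 (eq_zero_of_sum_mul he.nondeg (x := fun α => C.D (i2 α) (Φ (ix j)) -
    sgn ((εα α + 1) * εi j) • C.D (ix j) (Φ (i2 α))) (fun i => ?_) α)
  have h1 := twist_x_of_symm he hcomp hΦ hsymm 1 i j
  rw [twist_coeff_one, momComp_one, map_sum, Finset.smul_sum, ← sub_eq_zero,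
    ← Finset.sum_sub_distrib] at h1
  rw [← h1]
  refine Finset.sum_congr rfl fun α _ => ?_
  rw [D_mul _ (he.parity i α), he.indep i α j, zero_mul, zero_add, mul_sub, mul_smul_comm,
    smul_smul, sgn_mul_sgn, parity_ix]
  congr 3
  generalize εi i = y
  generalize εi j = z
  generalize εα α = w
  revert y z w; decide

include hcomp in
theorem twist_e_comm (i j α : Fin n) :
    C.twist (coeff e 1) i (e j α) =
      sgn ((εi i + 1) * (εi j + 1)) • C.twist (coeff e 1) j (e i α) := by
  have h := twist_coeff_comm hcomp 1 i j (C.Γ (i2 α))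
  rwa [twist_mom, twist_mom] at h

include he hcomp hΦ hsymm in
/-- The one-form `Φ` is closed along `ξ_2`. -/
theorem D_i2_i2_of_symm (β α : Fin n) :
    C.D (i2 β) (Φ (i2 α)) = sgn ((εα β + 1) * (εα α + 1)) • C.D (i2 α) (Φ (i2 β)) := by
  have hd := isCoeff_coeff he 1
  -- The integrability condition of the second bracket, arranged so that e can be cancelled twice,
  -- first in β and then in α.
  have key : ∀ i j, ∑ β, e i β * (sgn ((εα β + 1) * εi j) • ∑ α, e j α *
      (sgn ((εα β + 1) * εα α) • C.D (i2 β) (Φ (i2 α)) -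
        sgn (εα β + 1) • C.D (i2 α) (Φ (i2 β)))) = 0 := by
    intro i j
    have h1 := twist_momComp_of_symm he hcomp hΦ hsymm 1 i j
    simp only [momComp_one, map_sum, twist_mul hd (he.parity _ _), Finset.smul_sum] at h1
    simp only [smul_add, Finset.sum_add_distrib, twist_e_comm hcomp i j, smul_mul_assoc]
      at h1
    -- The terms with derivatives of e agree on both sides by `twist_e_comm`.
    have h2 := add_left_cancel h1
    rw [← sub_eq_zero] at h2
    rw [← h2]
    simp only [twist_coeff_one, Finset.mul_sum, Finset.smul_sum]
    rw [Finset.sum_comm (f := fun α β => sgn ((εi i + 1) * (εi j + εα α)) •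
      (e j α * (e i β * C.D (i2 β) (Φ (i2 α))))), ← Finset.sum_sub_distrib]
    refine Finset.sum_congr rfl fun β _ => ?_
    rw [← Finset.sum_sub_distrib]
    refine Finset.sum_congr rfl fun α _ => ?_
    rw [← mul_assoc (e j α) (e i β), (he.parity j α).mul_comm (he.parity i β)]
    simp only [mul_sub, smul_sub, mul_smul_comm, smul_mul_assoc, smul_smul, sgn_mul_sgn,
      mul_assoc]
    congr 3
    · generalize εi i = y
      generalize εi j = z
      generalize εα α = w
      generalize εα β = v
      revert y z w v; decide
    · generalize εi i = y
      generalize εi j = z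
      generalize εα α = w
      generalize εα β = v
      revert y z w v; decide
  have h3 := eq_zero_of_sum_mul he.nondeg (x := fun α =>
      (sgn ((εα β + 1) * εα α) • C.D (i2 β) (Φ (i2 α)) -
        sgn (εα β + 1) • C.D (i2 α) (Φ (i2 β)))) (fun j => by
    have := eq_zero_of_sum_mul he.nondeg (fun i => key i j) β
    exact (smul_eq_zero.1 this).resolve_left (sgn_ne_zero _)) α
  have h4 := congrArg (sgn ((εα β + 1) * εα α) • ·) (sub_eq_zero.1 h3)
  simp only [smul_smul, sgn_mul_self, one_smul, sgn_mul_sgn] at h4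
  rw [h4]
  congr 2
  generalize εα α = w
  generalize εα β = v
  revert w v; decide

theorem closed_symm {a b : Idx n} (h : C.D a (Φ b) =
    sgn (parity εi εα a * parity εi εα b) • C.D b (Φ a)) :
    C.D b (Φ a) = sgn (parity εi εα b * parity εi εα a) • C.D a (Φ b) := by
  rw [h, smul_smul, mul_comm (parity εi εα b), sgn_mul_self, one_smul]

include he hcomp hΦ hsymm in
-- Closedness is known along x together with one family of momenta; the other family enters as
-- parameters. No relation between the ξ_1 and ξ_2 components is at hand, hence one potential for
-- each bracket.
theorem exists_potential_of_symm (k : Fin 2) :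
    ∃ h : A, C.HasParity h 0 ∧ (∀ i, C.D (ix i) h = Φ (ix i)) ∧
      ∀ i, C.twist (coeff e k) i h = momComp e Φ k i := by
  have hx := D_x_of_symm he hcomp hΦ hsymm
  fin_cases k
  · have h1 := twist_x_of_symm he hcomp hΦ hsymm 0
    have h2 := twist_momComp_of_symm he hcomp hΦ hsymm 0
    simp only [twist_coeff_zero, momComp_zero] at h1 h2
    obtain ⟨h, hh, hS⟩ := C.exists_potential
      (Finset.univ.disjSum (Finset.univ.disjSum ∅)) Φ hΦ (by
        rintro (i | i | α) ha (j | j | β) hb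
        · exact hx i j
        · exact closed_symm (h1 j i)
        · simp at hb
        · exact h1 i j
        · exact h2 i j
        · simp at hb
        all_goals simp at ha)
    refine ⟨h, hh, fun i => hS _ (by simp), fun i => ?_⟩
    simp only [Fin.zero_eta]
    rw [twist_coeff_zero, momComp_zero]
    exact hS _ (by simp)
  · have h1 := D_i2_x_of_symm he hcomp hΦ hsymm
    have h2 := D_i2_i2_of_symm he hcomp hΦ hsymm
    obtain ⟨h, hh, hS⟩ := C.exists_potential
      (Finset.univ.disjSum (Finset.disjSum ∅ Finset.univ)) Φ hΦ (by
        rintro (i | i | α) ha (j | j | β) hb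
        · exact hx i j
        · simp at hb
        · exact closed_symm (h1 β i)
        · simp at ha
        · simp at ha
        · simp at ha
        · exact h1 α j
        · simp at hb
        · exact h2 α β)
    refine ⟨h, hh, fun i => hS _ (by simp), fun i => ?_⟩
    simp only [Fin.mk_one]
    rw [twist_coeff_one, momComp_one]
    exact Finset.sum_congr rfl fun α _ => by rw [hS _ (by simp)]

include he hcomp hΦ in
/-- A pair of vector fields made of a covector field differentiates the weakly canonical brackets
in the symmetrized sense if and only if it is generated by `h ∓ H / 2`. -/
theorem differentiateSymm_iff :
    C.DifferentiateSymm (fun a => C.vectorField (C.weakBracket e a) Φ) (C.weakBracket e) ↔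
      ∃ H h : A, C.HasParity H 0 ∧ C.HasParity h 0 ∧ C.IndepX H ∧ C.SolvesHEquation e H ∧
        (∀ f, C.vectorField (C.weakBracket e 0) Φ f =
          C.weakBracket e 0 (-(1 / 2 : ℝ) • H) f + C.weakBracket e 0 h f) ∧
        (∀ f, C.vectorField (C.weakBracket e 1) Φ f =
          C.weakBracket e 1 ((1 / 2 : ℝ) • H) f + C.weakBracket e 1 h f) := by
  refine ⟨fun hsymm => ?_, fun ⟨H, h, hH, hh, hHx, hHe, hV0, hV1⟩ =>
    differentiateSymm_of_exists he hcomp hH hh hHx hHe hV0 hV1⟩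
  obtain ⟨h₀, hh₀, hx₀, ht₀⟩ := exists_potential_of_symm he hcomp hΦ hsymm 0
  obtain ⟨h₁, hh₁, hx₁, ht₁⟩ := exists_potential_of_symm he hcomp hΦ hsymm 1
  have hV : ∀ (k : Fin 2) (h : A), C.HasParity h 0 → (∀ i, C.D (ix i) h = Φ (ix i)) →
      (∀ i, C.twist (coeff e k) i h = momComp e Φ k i) → ∀ f,
      C.vectorField (C.weakBracket e k) Φ f = C.weakBracket e k h f := by
    intro k h hh hx ht f
    rw [vectorField_weakBracket he hcomp hΦ, weakBracket_eq, bracket_even_left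
      (isCoeff_coeff he k) (isAntibracket_bracket hcomp k) hh, hamField]
    simp only [hx, ht]
  -- Solves h₀ = h - H/2 and h₁ = h + H/2.
  refine ⟨h₁ - h₀, (1 / 2 : ℝ) • (h₀ + h₁), hh₁.sub hh₀, (hh₀.add hh₁).smul _, fun i => ?_,
    fun i j => ?_, fun f => ?_, fun f => ?_⟩
  · rw [map_sub, hx₀, hx₁, sub_self]
  -- The mixed condition on (x^i, x^j) constrains T^2 T^1 h₀ + T^1 T^2 h₁. The mixed commutation
  -- relation applied to h₁ trades T^1 T^2 h₁ for T^2 T^1 h₁ with the opposite sign, which leaves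
  -- the equation for h₁ - h₀.
  · have h2 := hsymm 0 1 _ _ _ _ (hasParity_Γ (ix i)) (hasParity_Γ (ix j))
    simp only [vectorField_weakBracket he hcomp hΦ] at h2
    simp only [weakBracket_eq, bracket_x_left (isAntibracket_bracket hcomp 0),
      bracket_x_left (isAntibracket_bracket hcomp 1), twist_x, hamField_zero, hamField_x,
      parity_ix, add_zero] at h2
    have h3 := bracket_x_x (isAntibracket_bracket hcomp 1) (hasParity_momComp he hΦ 0) i j
    have h4 := bracket_x_x (isAntibracket_bracket hcomp 0) (hasParity_momComp he hΦ 1) i j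
    simp only [bracket_x_left (isAntibracket_bracket hcomp 0),
      bracket_x_left (isAntibracket_bracket hcomp 1), ← ht₀, ← ht₁] at h2 h3 h4
    have h5 : sgn (εi i + 1 + εi j) •
        ((C.twist (coeff e 1) i (C.twist (coeff e 0) j h₀) -
          sgn ((εi i + 1) * (εi j + 1)) • C.twist (coeff e 1) j (C.twist (coeff e 0) i h₀)) +
        (C.twist (coeff e 0) i (C.twist (coeff e 1) j h₁) -
          sgn ((εi i + 1) * (εi j + 1)) • C.twist (coeff e 0) j (C.twist (coeff e 1) i h₁)))
        = 0 := by
      linear_combination (norm := module) (-1 : ℝ) • h2 - (1 : ℝ) • h3 - (1 : ℝ) • h4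
    have h6 := (smul_eq_zero.1 h5).resolve_left (sgn_ne_zero _)
    have h7 := twist_coeff_comm_mixed hcomp i j h₁
    have h8 : C.twist (coeff e 1) i (C.twist (coeff e 0) j (h₁ - h₀)) -
        sgn ((εi i + 1) * (εi j + 1)) •
          C.twist (coeff e 1) j (C.twist (coeff e 0) i (h₁ - h₀)) = 0 := by
      simp only [map_sub]
      linear_combination (norm := module) (1 : ℝ) • h7 - (1 : ℝ) • h6
    simpa only [twist_coeff_zero, twist_coeff_one] using h8
  · rw [← (hcomp.isAntibracket 0).add_left, hV 0 h₀ hh₀ hx₀ ht₀]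
    congr 1
    module
  · rw [← (hcomp.isAntibracket 1).add_left, hV 1 h₁ hh₁ hx₁ ht₁]
    congr 1
    module

end Potentials

end Weak

end SuperCalculus
-- Transfer to superfunctions
/-- The calculus of superfunctions on a box. -/
def superFunCalculus {ι : Type} [Fintype ι] [DecidableEq ι] {par : ι → ZMod 2}
    {U : TopologicalSpace.Opens (EvenSpace par)} (hU : IsBox U) :
    SuperCalculus par (SuperFun U) where
  σ := parityAut
  D := leftD
  Dr := rightD
  Γ := coord U
  σ_one := parityAut_one
  σ_mul := parityAut_mul
  σ_σ := parityAut_parityAut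
  mul_comm' _ _ _ _ hf hg := mul_comm_of_hasParity hf hg
  σ_D := parityAut_leftD
  D_mul' a _ _ g hf := leftD_mul a hf g
  D_comm := leftD_comm
  Dr_eq' a _ _ hf := rightD_eq a hf
  D_one := leftD_one
  D_Γ := leftD_coord
  σ_Γ := hasParity_coord
  exists_D_eq' c S hc _ hf hfc hfS := exists_leftD_eq hU c S hc hf hfc hfS

section Transfer

variable {ι : Type} [Fintype ι] [DecidableEq ι] {par : ι → ZMod 2}
  {U : TopologicalSpace.Opens (EvenSpace par)} (hU : IsBox U)

theorem isAntibracket_superFunCalculus {B : SuperFun U → SuperFun U → SuperFun U}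
    (hB : IsAntibracket B) : (superFunCalculus hU).IsAntibracket B where
  add_left := hB.add_left
  smul_left := hB.smul_left
  add_right := hB.add_right
  smul_right := hB.smul_right
  parity := hB.parity
  antisymm := hB.antisymm
  jacobi := hB.jacobi

end Transfer

end Triplectic
end

theorem mainTheorem3 {n : ℕ} (εi εα : Fin n → ZMod 2)
    (U : TopologicalSpace.Opens (Triplectic.EvenSpace (Triplectic.parity εi εα)))
    (hU : Triplectic.IsBox U)
    (e : Matrix (Fin n) (Fin n) (Triplectic.SuperFun U))
    (he : Triplectic.IsEStructure e)
    (hcomp : Triplectic.Compatible (Triplectic.weakBracket e))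
    (Φ : Triplectic.Idx n → Triplectic.SuperFun U)
    (hΦ : ∀ A, Triplectic.HasParity (Φ A) (Triplectic.parity εi εα A)) :
    Triplectic.DifferentiateSymm
        (fun a => Triplectic.vectorField (Triplectic.weakBracket e a) Φ)
        (Triplectic.weakBracket e) ↔
      ∃ H h : Triplectic.SuperFun U,
        Triplectic.HasParity H 0 ∧ Triplectic.HasParity h 0 ∧
        Triplectic.IndepX H ∧ Triplectic.SolvesHEquation e H ∧
        (∀ f, Triplectic.vectorField (Triplectic.weakBracket e 0) Φ f =
          Triplectic.weakBracket e 0 (-(1 / 2 : ℝ) • H) f + Triplectic.weakBracket e 0 h f) ∧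
        (∀ f, Triplectic.vectorField (Triplectic.weakBracket e 1) Φ f =
          Triplectic.weakBracket e 1 ((1 / 2 : ℝ) • H) f + Triplectic.weakBracket e 1 h f) :=
  Triplectic.SuperCalculus.differentiateSymm_iff (C := Triplectic.superFunCalculus hU)
    ⟨he.parity, he.indep, he.nondeg⟩
    (fun α β => Triplectic.isAntibracket_superFunCalculus hU (hcomp α β)) hΦ
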